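/- Let $N$ be an Orlicz function, i.e. $N:[0,\infty)\to[0,\infty)$ is convex, continuous and (strictly) increasing, $N(0)=0$ and $\lim_{u\to\infty}N(u)=\infty$; let $N^{-1}:[0,\infty)\to[0,\infty)$ be its inverse function. Let $L_N$ be the Orlicz space of (classes of) measurable functions $x:(0,\infty)\to\mathbb R$ with finite norm $$\|x\|_{L_N}=\inf\Big\{u>0:\ \int_0^\infty N\big(|x(t)|/u\big)\,dt\le 1\Big\}.$$ Put $$\alpha_N=-\lim_{n\to\infty}\frac1n\log_2\sup_{k\in\mathbb Z}\frac{N^{-1}(2^{k-n})}{N^{-1}(2^k)},\qquad \beta_N=\lim_{n\to\infty}\frac1n\log_2\sup_{k\in\mathbb Z}\frac{N^{-1}(2^{k})}{N^{-1}(2^{k-n})},$$ $$\beta_N^0=\lim_{n\to\infty}\frac1n\log_2\sup_{k\ge 0}\frac{N^{-1}(2^{k+n})}{N^{-1}(2^{k})},\qquad \alpha_N^\infty=-\lim_{n\to\infty}\frac1n\log_2\sup_{k\le 0}\frac{N^{-1}(2^{k-n})}{N^{-1}(2^k)},$$ where $k$ runs over integers (these limits exist). Let $\mathcal F(L_N)$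 be the set of all $p\in[1,\infty]$ such that $\ell^p$ is symmetrically finitely represented in $L_N$: for every $n\in\mathbb N$ and $\varepsilon>0$ there are $x_1,\dots,x_n\in L_N$ with pairwise disjoint supports which are equimeasurable (i.e. $m\{s>0:|x_i(s)|>\tau\}=m\{s>0:|x_j(s)|>\tau\}$ for all $\tau>0$ and all $i,j$, with $m$ Lebesgue measure) such that $$(1+\varepsilon)^{-1}\|a\|_p\le\Big\|\sum_{k=1}^n a_kx_k\Big\|_{L_N}\le(1+\varepsilon)\|a\|_p\qquad\text{for all }a=(a_k)_{k=1}^n\in\mathbb R^n .$$ Suppose that $\alpha_N>0$. Then: (i) if $\alpha_N^\infty\le\beta_N^0$, then $\mathcal F(L_N)=[1/\beta_N,\,1/\alpha_N]$; (ii) if $\alpha_N^\infty>\beta_N^0$, then $\mathcal F(L_N)=[1/\beta_N,\,1/\alpha_N^\infty]\cup[1/\beta_N^0,\,1/\alpha_N]$. -/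

import Mathlib

open Set Filter Topology MeasureTheory
open scoped ENNReal

/-- An Orlicz function: a convex, continuous, (strictly) increasing function on `[0,∞)` with
`N(0) = 0` and `N(∞) = ∞`. Only the values of `N` on `[0,∞)` matter. -/
structure IsOrliczFunction (N : ℝ → ℝ) : Prop where
  convex : ConvexOn ℝ (Ici 0) N
  continuous : ContinuousOn N (Ici 0)
  increasing : StrictMonoOn N (Ici 0)
  map_zero : N 0 = 0
  tendsto_top : Tendsto N atTop atTop

/-- Lebesgue measure on `(0,∞)`. -/
noncomputable def halfLine : Measure ℝ := volume.restrict (Ioi 0)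

/-- The set of `u > 0` with `∫₀^∞ N(|x(t)|/u) dt ≤ 1`. -/
def luxemburgSet (N : ℝ → ℝ) (x : ℝ → ℝ) : Set ℝ :=
  {u : ℝ | 0 < u ∧ ∫⁻ t, ENNReal.ofReal (N (|x t| / u)) ∂halfLine ≤ 1}

/-- Membership in the Orlicz space `L_N` on `(0,∞)`: measurable with finite Luxemburg norm.
Functions stand for their classes modulo equality a.e. on `(0,∞)`. -/
def MemOrlicz (N : ℝ → ℝ) (x : ℝ → ℝ) : Prop :=
  AEMeasurable x halfLine ∧ (luxemburgSet N x).Nonempty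

/-- The Luxemburg norm of an element of `L_N`. -/
noncomputable def orliczNorm (N : ℝ → ℝ) (x : ℝ → ℝ) : ℝ := sInf (luxemburgSet N x)

/-- `m{s > 0 : |x(s)| > τ} = m{s > 0 : |y(s)| > τ}` for all `τ > 0`. -/
def Equimeasurable (x y : ℝ → ℝ) : Prop :=
  ∀ τ : ℝ, 0 < τ → halfLine {s | τ < |x s|} = halfLine {s | τ < |y s|}

/-- `x` and `y`, as classes of functions on `(0,∞)`, have disjoint supports. -/
def DisjointSupports (x y : ℝ → ℝ) : Prop := ∀ᵐ t ∂halfLine, x t = 0 ∨ y t = 0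

/-- `ℓ^p` is symmetrically finitely represented in `L_N`. -/
def SymmFinitelyRepresented (N : ℝ → ℝ) (p : ℝ≥0∞) : Prop :=
  ∀ (n : ℕ) (ε : ℝ), 0 < ε → ∃ x : Fin n → ℝ → ℝ,
    (∀ i, MemOrlicz N (x i)) ∧
    (∀ i j, Equimeasurable (x i) (x j)) ∧
    (∀ i j, i ≠ j → DisjointSupports (x i) (x j)) ∧
    ∀ a : Fin n → ℝ,
      (1 + ε)⁻¹ * ‖WithLp.toLp p a‖ ≤ orliczNorm N (fun t => ∑ k, a k * x k t) ∧
      orliczNorm N (fun t => ∑ k, a k * x k t) ≤ (1 + ε) * ‖WithLp.toLp p a‖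

/-- The set `𝓕(L_N)` of all `p ∈ [1,∞]` such that `ℓ^p` is symmetrically finitely
represented in `L_N`. -/
def symmReprSet (N : ℝ → ℝ) : Set ℝ≥0∞ := {p | 1 ≤ p ∧ SymmFinitelyRepresented N p}

/-- The inverse function `N⁻¹ : [0,∞) → [0,∞)`. -/
noncomputable def orliczInv (N : ℝ → ℝ) : ℝ → ℝ := Function.invFunOn N (Ici 0)

/-- `α_N = - lim (1/n) log₂ sup_{k ∈ ℤ} N⁻¹(2^(k-n)) / N⁻¹(2^k)`. -/
noncomputable def orliczAlpha (N : ℝ → ℝ) : ℝ :=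
  -limUnder atTop (fun n : ℕ => 1 / (n : ℝ) * Real.logb 2
    (⨆ k : ℤ, orliczInv N (2 ^ (k - (n : ℤ))) / orliczInv N (2 ^ k)))

/-- `β_N = lim (1/n) log₂ sup_{k ∈ ℤ} N⁻¹(2^k) / N⁻¹(2^(k-n))`. -/
noncomputable def orliczBeta (N : ℝ → ℝ) : ℝ :=
  limUnder atTop (fun n : ℕ => 1 / (n : ℝ) * Real.logb 2
    (⨆ k : ℤ, orliczInv N (2 ^ k) / orliczInv N (2 ^ (k - (n : ℤ)))))

/-- `β_N^0 = lim (1/n) log₂ sup_{k ≥ 0} N⁻¹(2^(k+n)) / N⁻¹(2^k)`. -/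
noncomputable def orliczBetaZero (N : ℝ → ℝ) : ℝ :=
  limUnder atTop (fun n : ℕ => 1 / (n : ℝ) * Real.logb 2
    (⨆ k : {k : ℤ // 0 ≤ k},
      orliczInv N (2 ^ ((k : ℤ) + (n : ℤ))) / orliczInv N (2 ^ (k : ℤ))))

/-- `α_N^∞ = - lim (1/n) log₂ sup_{k ≤ 0} N⁻¹(2^(k-n)) / N⁻¹(2^k)`. -/
noncomputable def orliczAlphaInfty (N : ℝ → ℝ) : ℝ :=
  -limUnder atTop (fun n : ℕ => 1 / (n : ℝ) * Real.logb 2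
    (⨆ k : {k : ℤ // k ≤ 0},
      orliczInv N (2 ^ ((k : ℤ) - (n : ℤ))) / orliczInv N (2 ^ (k : ℤ))))

/-! The limits in these definitions exist for every Orlicz function, and the suprema are of
bounded nonempty sets. -/

theorem orliczInv_spec {N : ℝ → ℝ} (hN : IsOrliczFunction N) {s : ℝ} (hs : 0 ≤ s) :
    0 ≤ orliczInv N s ∧ N (orliczInv N s) = s := by
  have hex : ∃ u ∈ Ici (0 : ℝ), N u = s := by
    obtain ⟨b, hb⟩ := (hN.tendsto_top.eventually_ge_atTop s).exists_forall_of_atTop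
    have hb' := hb (max b 0) (le_max_left _ _)
    have hc : ContinuousOn N (Icc 0 (max b 0)) :=
      hN.continuous.mono Icc_subset_Ici_self
    obtain ⟨u, hu, hu'⟩ := intermediate_value_Icc (le_max_right b 0) hc
      (show s ∈ Icc (N 0) (N (max b 0)) from ⟨by rw [hN.map_zero]; exact hs, hb'⟩)
    exact ⟨u, hu.1, hu'⟩
  exact ⟨Function.invFunOn_mem hex, Function.invFunOn_eq hex⟩

theorem orliczInv_pos {N : ℝ → ℝ} (hN : IsOrliczFunction N) {s : ℝ} (hs : 0 < s) :
    0 < orliczInv N s := by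
  obtain ⟨h1, h2⟩ := orliczInv_spec hN hs.le
  rcases h1.eq_or_lt with h | h
  · rw [← h, hN.map_zero] at h2
    exact absurd h2 hs.ne
  · exact h

theorem orliczInv_mono {N : ℝ → ℝ} (hN : IsOrliczFunction N) {s t : ℝ} (hs : 0 ≤ s)
    (hst : s ≤ t) : orliczInv N s ≤ orliczInv N t := by
  obtain ⟨h1, h2⟩ := orliczInv_spec hN hs
  obtain ⟨h3, h4⟩ := orliczInv_spec hN (hs.trans hst)
  by_contra! h
  have := hN.increasing h3 h1 h
  linarith

theorem orliczInv_mul_le {N : ℝ → ℝ} (hN : IsOrliczFunction N) {s c : ℝ} (hs : 0 ≤ s)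
    (hc : 1 ≤ c) : orliczInv N (c * s) ≤ c * orliczInv N s := by
  have hc0 : 0 < c := by linarith
  obtain ⟨h1, h2⟩ := orliczInv_spec hN hs
  obtain ⟨h3, h4⟩ := orliczInv_spec hN (mul_nonneg hc0.le hs)
  by_contra! h
  have h5 : orliczInv N s < c⁻¹ * orliczInv N (c * s) := by
    rw [inv_mul_eq_div, lt_div_iff₀ hc0]; linarith
  have h6 := hN.increasing h1 (mem_Ici.2 (h1.trans h5.le)) h5
  have h7 := hN.convex.2 (mem_Ici.2 h3) (mem_Ici.2 le_rfl) (inv_nonneg.2 hc0.le)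
    (sub_nonneg.2 (inv_le_one_of_one_le₀ hc)) (by ring)
  simp only [smul_eq_mul, mul_zero, add_zero, hN.map_zero, h4] at h7
  rw [h2] at h6
  rw [inv_mul_cancel_left₀ hc0.ne'] at h7
  linarith

theorem orlicz_ratio_bounds {N : ℝ → ℝ} (hN : IsOrliczFunction N) (k : ℤ) (n : ℕ) :
    0 < orliczInv N (2 ^ k) ∧ orliczInv N (2 ^ k) ≤ orliczInv N (2 ^ (k + (n : ℤ))) ∧
      orliczInv N (2 ^ (k + (n : ℤ))) ≤ 2 ^ n * orliczInv N (2 ^ k) := by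
  have h2 : (2 : ℝ) ^ (k + (n : ℤ)) = 2 ^ n * 2 ^ k := by
    rw [zpow_add₀ two_ne_zero, zpow_natCast, mul_comm]
  refine ⟨orliczInv_pos hN (by positivity), orliczInv_mono hN (by positivity) ?_, ?_⟩
  · exact zpow_le_zpow_right₀ one_le_two (by omega)
  · rw [h2]
    exact orliczInv_mul_le hN (by positivity) (one_le_pow₀ one_le_two)

/-- Existence of the limit for the supremum of a submultiplicative family of ratios. -/
theorem exists_tendsto_logb_iSup {ι : Type*} [Nonempty ι] (r : ι → ℕ → ℝ) {b C : ℝ}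
    (hb : 0 < b) (hlow : ∀ k n, b ^ n ≤ r k n) (hup : ∀ k n, r k n ≤ C ^ n)
    (hsub : ∀ k m n, ∃ k' k'', r k (m + n) = r k' m * r k'' n) :
    ∃ L : ℝ, Tendsto (fun n : ℕ => 1 / (n : ℝ) * Real.logb 2 (⨆ k, r k n)) atTop (𝓝 L) := by
  have hbdd : ∀ n, BddAbove (range fun k => r k n) := fun n =>
    ⟨C ^ n, by rintro _ ⟨k, rfl⟩; exact hup k n⟩
  have hge : ∀ n, b ^ n ≤ ⨆ k, r k n := fun n =>
    (hlow (Classical.arbitrary ι) n).trans (le_ciSup (hbdd n) _)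
  have hpos : ∀ n, 0 < ⨆ k, r k n := fun n => (pow_pos hb n).trans_le (hge n)
  have hS : Subadditive fun n : ℕ => Real.logb 2 (⨆ k, r k n) := by
    intro m n
    rw [← Real.logb_mul (hpos m).ne' (hpos n).ne']
    refine Real.logb_le_logb_of_le one_lt_two (hpos _) (ciSup_le fun k => ?_)
    obtain ⟨k', k'', h⟩ := hsub k m n
    rw [h]
    exact mul_le_mul (le_ciSup (hbdd m) k') (le_ciSup (hbdd n) k'')
      ((pow_pos hb n).le.trans (hlow _ _)) (hpos m).le
  have hB : BddBelow (range fun n : ℕ => Real.logb 2 (⨆ k, r k n) / n) := by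
    refine ⟨min 0 (Real.logb 2 b), ?_⟩
    rintro _ ⟨n, rfl⟩
    rcases Nat.eq_zero_or_pos n with rfl | hn
    · simp
    · refine (min_le_right _ _).trans ?_
      have hn' : (0 : ℝ) < n := Nat.cast_pos.2 hn
      show _ ≤ Real.logb 2 (⨆ k, r k n) / (n : ℝ)
      rw [le_div_iff₀ hn']
      have := Real.logb_le_logb_of_le one_lt_two (pow_pos hb n) (hge n)
      rw [Real.logb_pow] at this
      linarith
  refine ⟨hS.lim, (hS.tendsto_lim hB).congr fun n => ?_⟩
  rw [div_eq_mul_one_div, mul_comm]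

theorem tendsto_orliczAlpha {N : ℝ → ℝ} (hN : IsOrliczFunction N) :
    Tendsto (fun n : ℕ => 1 / (n : ℝ) * Real.logb 2
      (⨆ k : ℤ, orliczInv N (2 ^ (k - (n : ℤ))) / orliczInv N (2 ^ k))) atTop
      (𝓝 (-orliczAlpha N)) := by
  rw [orliczAlpha, neg_neg]
  refine tendsto_nhds_limUnder (exists_tendsto_logb_iSup (ι := ℤ)
    (fun k n => orliczInv N (2 ^ (k - (n : ℤ))) / orliczInv N (2 ^ k))
    (b := 1 / 2) (C := 1) (by norm_num) ?_ ?_ ?_)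
  · intro k n
    obtain ⟨h1, h2, h3⟩ := orlicz_ratio_bounds hN (k - n) n
    rw [sub_add_cancel] at h2 h3
    rw [one_div_pow, div_le_div_iff₀ (by positivity) (h1.trans_le h2)]
    linarith
  · intro k n
    obtain ⟨h1, h2, h3⟩ := orlicz_ratio_bounds hN (k - n) n
    rw [sub_add_cancel] at h2 h3
    rw [one_pow]
    exact div_le_one_of_le₀ h2 (h1.le.trans h2)
  · intro k m n
    refine ⟨k, k - m, ?_⟩
    have h1 := (orlicz_ratio_bounds hN (k - m) n).1
    push_cast
    rw [← sub_sub, mul_comm, div_mul_div_cancel₀ h1.ne']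

theorem tendsto_orliczAlphaInfty {N : ℝ → ℝ} (hN : IsOrliczFunction N) :
    Tendsto (fun n : ℕ => 1 / (n : ℝ) * Real.logb 2
      (⨆ k : {k : ℤ // k ≤ 0},
        orliczInv N (2 ^ ((k : ℤ) - (n : ℤ))) / orliczInv N (2 ^ (k : ℤ)))) atTop
      (𝓝 (-orliczAlphaInfty N)) := by
  rw [orliczAlphaInfty, neg_neg]
  have : Nonempty {k : ℤ // k ≤ 0} := ⟨⟨0, le_rfl⟩⟩
  refine tendsto_nhds_limUnder (exists_tendsto_logb_iSup (ι := {k : ℤ // k ≤ 0})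
    (fun k n => orliczInv N (2 ^ ((k : ℤ) - (n : ℤ))) / orliczInv N (2 ^ (k : ℤ)))
    (b := 1 / 2) (C := 1) (by norm_num) ?_ ?_ ?_)
  · rintro ⟨k, hk⟩ n
    obtain ⟨h1, h2, h3⟩ := orlicz_ratio_bounds hN (k - n) n
    rw [sub_add_cancel] at h2 h3
    rw [one_div_pow, div_le_div_iff₀ (by positivity) (h1.trans_le h2)]
    linarith
  · rintro ⟨k, hk⟩ n
    obtain ⟨h1, h2, h3⟩ := orlicz_ratio_bounds hN (k - n) n
    rw [sub_add_cancel] at h2 h3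
    rw [one_pow]
    exact div_le_one_of_le₀ h2 (h1.le.trans h2)
  · rintro ⟨k, hk⟩ m n
    refine ⟨⟨k, hk⟩, ⟨k - m, by omega⟩, ?_⟩
    have h1 := (orlicz_ratio_bounds hN (k - m) n).1
    push_cast
    rw [← sub_sub, mul_comm, div_mul_div_cancel₀ h1.ne']

theorem tendsto_orliczBeta {N : ℝ → ℝ} (hN : IsOrliczFunction N) :
    Tendsto (fun n : ℕ => 1 / (n : ℝ) * Real.logb 2
      (⨆ k : ℤ, orliczInv N (2 ^ k) / orliczInv N (2 ^ (k - (n : ℤ))))) atTop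
      (𝓝 (orliczBeta N)) := by
  refine tendsto_nhds_limUnder (exists_tendsto_logb_iSup (ι := ℤ)
    (fun k n => orliczInv N (2 ^ k) / orliczInv N (2 ^ (k - (n : ℤ))))
    (b := 1) (C := 2) one_pos ?_ ?_ ?_)
  · intro k n
    obtain ⟨h1, h2, h3⟩ := orlicz_ratio_bounds hN (k - n) n
    rw [sub_add_cancel] at h2 h3
    rw [one_pow]
    exact (one_le_div h1).2 h2
  · intro k n
    obtain ⟨h1, h2, h3⟩ := orlicz_ratio_bounds hN (k - n) n
    rw [sub_add_cancel] at h2 h3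
    exact (div_le_iff₀ h1).2 h3
  · intro k m n
    refine ⟨k, k - m, ?_⟩
    have h1 := (orlicz_ratio_bounds hN (k - m) n).1
    push_cast
    rw [← sub_sub, div_mul_div_cancel₀ h1.ne']

theorem tendsto_orliczBetaZero {N : ℝ → ℝ} (hN : IsOrliczFunction N) :
    Tendsto (fun n : ℕ => 1 / (n : ℝ) * Real.logb 2
      (⨆ k : {k : ℤ // 0 ≤ k},
        orliczInv N (2 ^ ((k : ℤ) + (n : ℤ))) / orliczInv N (2 ^ (k : ℤ)))) atTop
      (𝓝 (orliczBetaZero N)) := by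
  have : Nonempty {k : ℤ // 0 ≤ k} := ⟨⟨0, le_rfl⟩⟩
  refine tendsto_nhds_limUnder (exists_tendsto_logb_iSup (ι := {k : ℤ // 0 ≤ k})
    (fun k n => orliczInv N (2 ^ ((k : ℤ) + (n : ℤ))) / orliczInv N (2 ^ (k : ℤ)))
    (b := 1) (C := 2) one_pos ?_ ?_ ?_)
  · rintro ⟨k, hk⟩ n
    obtain ⟨h1, h2, h3⟩ := orlicz_ratio_bounds hN k n
    rw [one_pow]
    exact (one_le_div h1).2 h2
  · rintro ⟨k, hk⟩ n
    obtain ⟨h1, h2, h3⟩ := orlicz_ratio_bounds hN k n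
    exact (div_le_iff₀ h1).2 h3
  · rintro ⟨k, hk⟩ m n
    refine ⟨⟨k + n, by omega⟩, ⟨k, hk⟩, ?_⟩
    have h1 := (orlicz_ratio_bounds hN k n).1
    have h2 := (orlicz_ratio_bounds hN (k + n) m).1
    push_cast
    rw [div_mul_div_cancel₀ h2.ne', add_right_comm, add_assoc]

/-! For finite `p` everything depends on how `N t` compares with `t ^ p`. Pairwise disjoint
equimeasurable functions have additive modulars, so a sum `∑ a k * x k` has modular `∑ Φ (|a k| /
u)` at scale `u`, where `Φ s = ∫ N (s |x|)` for any one of them. A copy of `ℓ^p` therefore amounts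
to a function `x` with `Φ s` close to `s ^ p` on a long range of scales.

Call `p` bad if `β < 1/p`, or `1/p < α`, or both `β⁰ < 1/p` and `1/p < α^∞`. In terms of growth, `N`
beats a power larger than `p` everywhere, or stays below a power smaller than `p` everywhere, or
does the latter near `0` and the former near infinity. In each case a suitable dilation `l` makes `l
^ (-p) * N (l * t) + l ^ p * N (t / l)` exceed any given multiple of `N t`, for all `t` at once
(`SteepAround`). Integrating against `x` gives the same inequality for `Φ`, which contradicts `Φ s ≈
s ^ p` (`SteepAround.not_symmFinitelyRepresented`).

If `p` is not bad, the candidate is `r ^ (-1/p)` truncated to a window `(A, B]`. Replacing `s` by a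
smaller scale merely dilates the window, so the error in `Φ s ≈ s ^ p` is the mass of `N (r ^
(-1/p))` near the two ends. Windows with negligible ends give copies of `ℓ^p`
(`HasBroadWindows.symmFinitelyRepresented`). If there are none, the masses on geometric intervals
satisfy a Gronwall-type inequality that makes them grow exponentially away from a minimum. The
minimum may lie at minus infinity, at plus infinity or at a finite place, and these are exactly the
three bad cases (`indices_of_not_hasBroadWindows`).

The assumption `α > 0` bounds `N` above by a power and so excludes `p = ∞`. The two cases of the
theorem then come from rearranging inequalities between the indices. -/

theorem IsOrliczFunction.pos {N : ℝ → ℝ} (hN : IsOrliczFunction N) {t : ℝ} (ht : 0 < t) :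
    0 < N t := by
  have := hN.increasing (mem_Ici.2 le_rfl) (mem_Ici.2 ht.le) ht
  rwa [hN.map_zero] at this

theorem IsOrliczFunction.mono {N : ℝ → ℝ} (hN : IsOrliczFunction N) {s t : ℝ} (hs : 0 ≤ s)
    (hst : s ≤ t) : N s ≤ N t :=
  hN.increasing.monotoneOn (mem_Ici.2 hs) (mem_Ici.2 (hs.trans hst)) hst

theorem IsOrliczFunction.nonneg {N : ℝ → ℝ} (hN : IsOrliczFunction N) {t : ℝ} (ht : 0 ≤ t) :
    0 ≤ N t := by
  rw [← hN.map_zero]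
  exact hN.mono le_rfl ht

theorem orliczInv_apply {N : ℝ → ℝ} (hN : IsOrliczFunction N) {t : ℝ} (ht : 0 ≤ t) :
    orliczInv N (N t) = t :=
  hN.increasing.injOn.leftInvOn_invFunOn ht

/-! ### Power growth of `N` and its relation to the indices -/

/-- `(t / s) ^ q ≲ N t / N s` for all `t ≥ s` with `s ∈ S`. -/
def LowerGrowth (N : ℝ → ℝ) (S : Set ℝ) (q : ℝ) : Prop :=
  ∃ C : ℝ, 0 < C ∧ ∀ s ∈ S, ∀ t, s ≤ t → (t / s) ^ q * N s ≤ C * N t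

/-- `N t / N s ≲ (t / s) ^ q` for all `0 < s ≤ t` with `t ∈ S`. -/
def UpperGrowth (N : ℝ → ℝ) (S : Set ℝ) (q : ℝ) : Prop :=
  ∃ C : ℝ, 0 < C ∧ ∀ t ∈ S, ∀ s, 0 < s → s ≤ t → N t ≤ C * ((t / s) ^ q * N s)

theorem exists_bound_of_tendsto_logb_iSup {ι : Type*} [Nonempty ι] {r : ι → ℕ → ℝ}
    (hbdd : ∀ n, BddAbove (range fun k => r k n)) (hpos : ∀ k n, 0 < r k n) {x y : ℝ}
    (hlim : Tendsto (fun n : ℕ => 1 / (n : ℝ) * Real.logb 2 (⨆ k, r k n)) atTop (𝓝 x))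
    (hxy : x < y) : ∃ C : ℝ, 0 < C ∧ ∀ k n, r k n ≤ C * 2 ^ (y * n) := by
  have hS : ∀ n, 0 < ⨆ k, r k n := fun n =>
    (hpos (Classical.arbitrary ι) n).trans_le (le_ciSup (hbdd n) _)
  obtain ⟨n0, hn0⟩ := ((hlim.eventually_lt_const hxy).and
    (eventually_gt_atTop 0)).exists_forall_of_atTop
  have hterm : ∀ n : ℕ, 0 ≤ (⨆ k, r k n) / (2 : ℝ) ^ (y * n) := fun n =>
    div_nonneg (hS n).le (by positivity)
  -- The `1` serves all `n ≥ n0`, where the limit already gives the bound; the sum dominates the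
  -- finitely many earlier ratios.
  refine ⟨1 + ∑ n ∈ Finset.range n0, (⨆ k, r k n) / (2 : ℝ) ^ (y * n),
    by have := Finset.sum_nonneg fun n (_ : n ∈ Finset.range n0) => hterm n
       linarith, fun k n => (le_ciSup (hbdd n) k).trans ?_⟩
  have h2 : (0 : ℝ) < 2 ^ (y * n) := by positivity
  rw [← div_le_iff₀ h2]
  rcases lt_or_ge n n0 with h | h
  · have := Finset.single_le_sum (f := fun n : ℕ => (⨆ k, r k n) / (2 : ℝ) ^ (y * n))
      (fun n _ => hterm n) (Finset.mem_range.2 h)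
    linarith
  · obtain ⟨h3, h4⟩ := hn0 n h
    have hn : (0 : ℝ) < n := Nat.cast_pos.2 h4
    rw [one_div_mul_eq_div, div_lt_iff₀ hn, Real.logb_lt_iff_lt_rpow one_lt_two (hS n)] at h3
    have h5 : (⨆ k, r k n) / (2 : ℝ) ^ (y * n) ≤ 1 := (div_le_one h2).2 h3.le
    have := Finset.sum_nonneg fun n (_ : n ∈ Finset.range n0) => hterm n
    linarith

theorem le_of_tendsto_logb_iSup {ι : Type*} [Nonempty ι] {r : ι → ℕ → ℝ}
    (hpos : ∀ k n, 0 < r k n) {x y C : ℝ} (hC : 0 < C)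
    (hlim : Tendsto (fun n : ℕ => 1 / (n : ℝ) * Real.logb 2 (⨆ k, r k n)) atTop (𝓝 x))
    (hr : ∀ k n, r k n ≤ C * 2 ^ (y * n)) : x ≤ y := by
  have h1 : Tendsto (fun n : ℕ => 1 / (n : ℝ) * Real.logb 2 C + y) atTop (𝓝 y) := by
    simpa using (tendsto_one_div_atTop_nhds_zero_nat (𝕜 := ℝ)).mul_const (Real.logb 2 C)
      |>.add_const y
  refine le_of_tendsto_of_tendsto hlim h1 ?_
  filter_upwards [eventually_gt_atTop 0] with n hn
  have hn' : (0 : ℝ) < n := Nat.cast_pos.2 hn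
  have hS : 0 < ⨆ k, r k n := (hpos (Classical.arbitrary ι) n).trans_le
    (le_ciSup ⟨C * 2 ^ (y * n), by rintro _ ⟨k, rfl⟩; exact hr k n⟩ _)
  have h2 := Real.logb_le_logb_of_le one_lt_two hS (ciSup_le fun k => hr k n)
  rw [Real.logb_mul hC.ne' (by positivity), Real.logb_rpow (by norm_num) (by norm_num)] at h2
  have h3 : (1 / (n : ℝ)) * (y * n) = y := by field_simp
  calc _ ≤ 1 / (n : ℝ) * (Real.logb 2 C + y * n) := by gcongr
    _ = _ := by rw [mul_add, h3]

/-- Values of `N` are rounded down to powers of two. This costs only constants, since doubling the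
argument of `N⁻¹` at most doubles its value. Rounding down keeps the base exponent nonnegative when
`N s ≥ 1`, as the index `β⁰` requires. -/
theorem lowerGrowth_of_dyadic {N : ℝ → ℝ} (hN : IsOrliczFunction N) {K : Set ℤ} {C y : ℝ}
    (hC : 0 < C) (hy : 0 < y)
    (h : ∀ k ∈ K, ∀ n : ℕ, orliczInv N (2 ^ (k + (n : ℤ))) / orliczInv N (2 ^ k) ≤
      C * 2 ^ (y * n)) :
    LowerGrowth N {t | 0 < t ∧ Int.log 2 (N t) ∈ K} (1 / y) := by
  refine ⟨2 * (2 * C) ^ (1 / y), by positivity, ?_⟩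
  rintro s ⟨hs, hsK⟩ t hst
  have ht := hs.trans_le hst
  have hNs := hN.pos hs
  have hNt := hN.pos ht
  have hle : Int.log 2 (N s) ≤ Int.log 2 (N t) := Int.log_mono_right hNs (hN.mono hs.le hst)
  obtain ⟨n, hn⟩ := Int.eq_ofNat_of_zero_le (sub_nonneg.2 hle)
  have h1 := h _ hsK n
  have hkn : Int.log 2 (N s) + (n : ℤ) = Int.log 2 (N t) := by omega
  rw [div_le_iff₀ (orliczInv_pos hN (by positivity)), hkn] at h1
  have h2 : (2 : ℝ) ^ Int.log 2 (N s) ≤ N s := by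
    exact_mod_cast Int.zpow_log_le_self one_lt_two hNs
  have h2' : N s < (2 : ℝ) ^ (Int.log 2 (N s) + 1) := by
    exact_mod_cast Int.lt_zpow_succ_log_self one_lt_two (N s)
  have h3 : (2 : ℝ) ^ Int.log 2 (N t) ≤ N t := by
    exact_mod_cast Int.zpow_log_le_self one_lt_two hNt
  have h4 : N t < (2 : ℝ) ^ (Int.log 2 (N t) + 1) := by
    exact_mod_cast Int.lt_zpow_succ_log_self one_lt_two (N t)
  rw [zpow_add_one₀ two_ne_zero, mul_comm] at h4 h2'
  have h5 : t ≤ 2 * (C * 2 ^ (y * n)) * s := by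
    calc t = orliczInv N (N t) := (orliczInv_apply hN ht.le).symm
      _ ≤ orliczInv N (2 * 2 ^ Int.log 2 (N t)) := orliczInv_mono hN hNt.le h4.le
      _ ≤ 2 * orliczInv N (2 ^ Int.log 2 (N t)) := orliczInv_mul_le hN (by positivity) (by norm_num)
      _ ≤ 2 * (C * 2 ^ (y * n) * orliczInv N (2 ^ Int.log 2 (N s))) := by gcongr
      _ ≤ 2 * (C * 2 ^ (y * n) * orliczInv N (N s)) := by
        gcongr; exact orliczInv_mono hN (by positivity) h2
      _ = _ := by rw [orliczInv_apply hN hs.le]; ring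
  have h6 : (t / s) ^ (1 / y) ≤ (2 * C) ^ (1 / y) * 2 ^ n := by
    calc (t / s) ^ (1 / y) ≤ (2 * C * 2 ^ (y * n)) ^ (1 / y) := by
          refine Real.rpow_le_rpow (by positivity) ?_ (by positivity)
          rw [div_le_iff₀ hs]; linarith
      _ = _ := by
          rw [Real.mul_rpow (by positivity) (by positivity), ← Real.rpow_mul (by norm_num)]
          congr 1
          rw [show y * n * (1 / y) = n by field_simp, Real.rpow_natCast]
  calc (t / s) ^ (1 / y) * N s ≤ (2 * C) ^ (1 / y) * 2 ^ n * (2 * 2 ^ Int.log 2 (N s)) := by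
        gcongr
    _ = 2 * (2 * C) ^ (1 / y) * 2 ^ Int.log 2 (N t) := by
        rw [← hkn, zpow_add₀ two_ne_zero, zpow_natCast]; ring
    _ ≤ _ := by gcongr

/-- Here values are rounded up, so that `N t ≤ 1` gives a nonpositive exponent, as needed for `α^∞`.
-/
theorem upperGrowth_of_dyadic {N : ℝ → ℝ} (hN : IsOrliczFunction N) {K : Set ℤ} {C y : ℝ}
    (hC : 0 < C) (hy : 0 < y)
    (h : ∀ k ∈ K, ∀ n : ℕ, orliczInv N (2 ^ (k - (n : ℤ))) / orliczInv N (2 ^ k) ≤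
      C * 2 ^ (-y * n)) :
    UpperGrowth N {t | 0 < t ∧ Int.clog 2 (N t) ∈ K} (1 / y) := by
  refine ⟨2 * (2 * C) ^ (1 / y), by positivity, ?_⟩
  rintro t ⟨ht, htK⟩ s hs hst
  have hNs := hN.pos hs
  have hNt := hN.pos ht
  have hle : Int.clog 2 (N s) ≤ Int.clog 2 (N t) := Int.clog_mono_right hNs (hN.mono hs.le hst)
  obtain ⟨n, hn⟩ := Int.eq_ofNat_of_zero_le (sub_nonneg.2 hle)
  have h1 := h _ htK n
  have hkn : Int.clog 2 (N t) - (n : ℤ) = Int.clog 2 (N s) := by omega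
  rw [div_le_iff₀ (orliczInv_pos hN (by positivity)), hkn] at h1
  have h2 : N s ≤ (2 : ℝ) ^ Int.clog 2 (N s) := by
    exact_mod_cast Int.self_le_zpow_clog one_lt_two (N s)
  have h2' : (2 : ℝ) ^ (Int.clog 2 (N s) - 1) < N s := by
    exact_mod_cast Int.zpow_pred_clog_lt_self one_lt_two hNs
  have h3 : N t ≤ (2 : ℝ) ^ Int.clog 2 (N t) := by
    exact_mod_cast Int.self_le_zpow_clog one_lt_two (N t)
  have h4 : (2 : ℝ) ^ (Int.clog 2 (N t) - 1) < N t := by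
    exact_mod_cast Int.zpow_pred_clog_lt_self one_lt_two hNt
  rw [zpow_sub_one₀ two_ne_zero] at h4 h2'
  have h5 : s ≤ C * 2 ^ (-y * n) * (2 * t) := by
    calc s = orliczInv N (N s) := (orliczInv_apply hN hs.le).symm
      _ ≤ orliczInv N (2 ^ Int.clog 2 (N s)) := orliczInv_mono hN hNs.le h2
      _ ≤ C * 2 ^ (-y * n) * orliczInv N (2 ^ Int.clog 2 (N t)) := h1
      _ ≤ C * 2 ^ (-y * n) * orliczInv N (2 * N t) := by
        gcongr; exact orliczInv_mono hN (by positivity) (by linarith)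
      _ ≤ C * 2 ^ (-y * n) * (2 * orliczInv N (N t)) := by
        gcongr; exact orliczInv_mul_le hN hNt.le (by norm_num)
      _ = _ := by rw [orliczInv_apply hN ht.le]
  have h6 : (2 : ℝ) ^ n ≤ (2 * C) ^ (1 / y) * (t / s) ^ (1 / y) := by
    rw [← Real.mul_rpow (by positivity) (by positivity)]
    calc (2 : ℝ) ^ n = (2 ^ (y * n)) ^ (1 / y) := by
          rw [← Real.rpow_mul (by norm_num), show y * n * (1 / y) = n by field_simp,
            Real.rpow_natCast]
      _ ≤ _ := by
          refine Real.rpow_le_rpow (by positivity) ?_ (by positivity)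
          rw [← mul_div_assoc, le_div_iff₀ hs]
          rw [neg_mul, Real.rpow_neg (by norm_num)] at h5
          calc (2 : ℝ) ^ (y * n) * s ≤
              2 ^ (y * n) * (C * (2 ^ (y * n))⁻¹ * (2 * t)) := by gcongr
            _ = _ := by field_simp
  calc N t ≤ 2 ^ Int.clog 2 (N t) := h3
    _ = 2 ^ n * 2 ^ Int.clog 2 (N s) := by
        rw [← hkn, zpow_sub₀ two_ne_zero, zpow_natCast]; field_simp
    _ ≤ ((2 * C) ^ (1 / y) * (t / s) ^ (1 / y)) * (2 * N s) := by
        gcongr; linarith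
    _ = _ := by ring

/-- The growth condition is read at points where `N` is exactly a power of two; a `q`-th root then
bounds the ratio of inverses. -/
theorem orliczInv_add_div_le {N : ℝ → ℝ} (hN : IsOrliczFunction N) {S : Set ℝ} {q C : ℝ}
    (hq : 0 < q) (hC : 0 < C)
    (hG : ∀ s ∈ S, ∀ t, s ≤ t → (t / s) ^ q * N s ≤ C * N t) {k : ℤ}
    (hk : orliczInv N (2 ^ k) ∈ S) (n : ℕ) :
    orliczInv N (2 ^ (k + (n : ℤ))) / orliczInv N (2 ^ k) ≤ C ^ (1 / q) * 2 ^ (1 / q * n) := by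
  obtain ⟨h1, h2, h3⟩ := orlicz_ratio_bounds hN k n
  have h4 := hG _ hk _ h2
  rw [(orliczInv_spec hN (by positivity)).2, (orliczInv_spec hN (by positivity)).2,
    zpow_add₀ two_ne_zero, zpow_natCast] at h4
  set x := orliczInv N (2 ^ (k + (n : ℤ))) / orliczInv N (2 ^ k) with hx
  rw [zpow_add₀ two_ne_zero, zpow_natCast] at hx
  rw [← hx] at h4
  have hx0 : 0 ≤ x := div_nonneg (h1.le.trans h2) h1.le
  have h5 : x ^ q ≤ C * 2 ^ n := by
    refine le_of_mul_le_mul_right (a := (2 : ℝ) ^ k) ?_ (by positivity)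
    linarith
  calc x = (x ^ q) ^ (1 / q) := by rw [← Real.rpow_mul hx0, mul_one_div_cancel hq.ne', Real.rpow_one]
    _ ≤ (C * 2 ^ n) ^ (1 / q) := Real.rpow_le_rpow (by positivity) h5 (by positivity)
    _ = _ := by
      rw [Real.mul_rpow hC.le (by positivity), ← Real.rpow_natCast, ← Real.rpow_mul (by norm_num),
        mul_comm (n : ℝ)]

theorem orliczInv_sub_div_le {N : ℝ → ℝ} (hN : IsOrliczFunction N) {S : Set ℝ} {q C : ℝ}
    (hq : 0 < q) (hC : 0 < C)
    (hG : ∀ t ∈ S, ∀ s, 0 < s → s ≤ t → N t ≤ C * ((t / s) ^ q * N s)) {k : ℤ}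
    (hk : orliczInv N (2 ^ k) ∈ S) (n : ℕ) :
    orliczInv N (2 ^ (k - (n : ℤ))) / orliczInv N (2 ^ k) ≤
      C ^ (1 / q) * 2 ^ (-(1 / q) * n) := by
  obtain ⟨h1, h2, h3⟩ := orlicz_ratio_bounds hN (k - n) n
  rw [sub_add_cancel] at h2 h3
  have h4 := hG _ hk _ h1 h2
  rw [(orliczInv_spec hN (by positivity)).2, (orliczInv_spec hN (by positivity)).2] at h4
  have hk2 : (2 : ℝ) ^ k = 2 ^ n * 2 ^ (k - (n : ℤ)) := by
    rw [zpow_sub₀ two_ne_zero, zpow_natCast]; field_simp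
  set a := orliczInv N (2 ^ (k - (n : ℤ)))
  set b := orliczInv N (2 ^ k)
  have hb : 0 < b := h1.trans_le h2
  have h5 : (2 : ℝ) ^ n ≤ C * (b / a) ^ q := by
    refine le_of_mul_le_mul_right (a := (2 : ℝ) ^ (k - (n : ℤ))) ?_ (by positivity)
    linarith
  have h6 : (2 : ℝ) ^ (1 / q * n) ≤ C ^ (1 / q) * (b / a) := by
    calc (2 : ℝ) ^ (1 / q * n) = (2 ^ n) ^ (1 / q) := by
          rw [← Real.rpow_natCast, ← Real.rpow_mul (by norm_num), mul_comm]
      _ ≤ (C * (b / a) ^ q) ^ (1 / q) := Real.rpow_le_rpow (by positivity) h5 (by positivity)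
      _ = _ := by
        rw [Real.mul_rpow hC.le (by positivity), ← Real.rpow_mul (by positivity),
          mul_one_div_cancel hq.ne', Real.rpow_one]
  rw [neg_mul, Real.rpow_neg (by norm_num), ← div_eq_mul_inv, div_le_div_iff₀ hb (by positivity)]
  calc a * 2 ^ (1 / q * n) ≤ a * (C ^ (1 / q) * (b / a)) := by gcongr
    _ = _ := by field_simp

theorem orliczBeta_bounds {N : ℝ → ℝ} (hN : IsOrliczFunction N) (k : ℤ) (n : ℕ) :
    0 < orliczInv N (2 ^ k) / orliczInv N (2 ^ (k - (n : ℤ))) ∧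
      orliczInv N (2 ^ k) / orliczInv N (2 ^ (k - (n : ℤ))) ≤ 2 ^ n := by
  obtain ⟨h1, h2, h3⟩ := orlicz_ratio_bounds hN (k - n) n
  rw [sub_add_cancel] at h2 h3
  exact ⟨div_pos (h1.trans_le h2) h1, (div_le_iff₀ h1).2 h3⟩

theorem orliczBetaZero_bounds {N : ℝ → ℝ} (hN : IsOrliczFunction N) (k : ℤ) (n : ℕ) :
    0 < orliczInv N (2 ^ (k + (n : ℤ))) / orliczInv N (2 ^ k) ∧
      orliczInv N (2 ^ (k + (n : ℤ))) / orliczInv N (2 ^ k) ≤ 2 ^ n := by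
  obtain ⟨h1, h2, h3⟩ := orlicz_ratio_bounds hN k n
  exact ⟨div_pos (h1.trans_le h2) h1, (div_le_iff₀ h1).2 h3⟩

theorem orliczAlpha_bounds {N : ℝ → ℝ} (hN : IsOrliczFunction N) (k : ℤ) (n : ℕ) :
    0 < orliczInv N (2 ^ (k - (n : ℤ))) / orliczInv N (2 ^ k) ∧
      orliczInv N (2 ^ (k - (n : ℤ))) / orliczInv N (2 ^ k) ≤ 1 := by
  obtain ⟨h1, h2, h3⟩ := orlicz_ratio_bounds hN (k - n) n
  rw [sub_add_cancel] at h2 h3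
  exact ⟨div_pos h1 (h1.trans_le h2), div_le_one_of_le₀ h2 (h1.le.trans h2)⟩

instance : Nonempty {k : ℤ // k ≤ 0} := ⟨⟨0, le_rfl⟩⟩

instance : Nonempty {k : ℤ // 0 ≤ k} := ⟨⟨0, le_rfl⟩⟩

theorem exists_lowerGrowth_of_orliczBeta_lt {N : ℝ → ℝ} (hN : IsOrliczFunction N) {p : ℝ}
    (hp : 0 < p) (h : orliczBeta N < 1 / p) : ∃ q, p < q ∧ LowerGrowth N (Ioi 0) q := by
  -- The maximum with `0` keeps `y` positive, so that `1 / y` is a usable growth exponent.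
  obtain ⟨y, hy, hyp⟩ := exists_between (max_lt h (one_div_pos.2 hp))
  have hy0 : 0 < y := (le_max_right _ _).trans_lt hy
  obtain ⟨C, hC, hr⟩ := exists_bound_of_tendsto_logb_iSup
    (fun n => ⟨2 ^ n, by rintro _ ⟨k, rfl⟩; exact (orliczBeta_bounds hN k n).2⟩)
    (fun k n => (orliczBeta_bounds hN k n).1) (tendsto_orliczBeta hN)
    ((le_max_left _ _).trans_lt hy)
  refine ⟨1 / y, (lt_one_div hp hy0).2 hyp, ?_⟩
  obtain ⟨D, hD, hG⟩ := lowerGrowth_of_dyadic hN (K := univ) hC hy0 fun k _ n => by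
    have := hr (k + n) n
    rwa [add_sub_cancel_right] at this
  exact ⟨D, hD, fun s hs => hG s ⟨hs, trivial⟩⟩

theorem orliczBeta_lt_of_lowerGrowth {N : ℝ → ℝ} (hN : IsOrliczFunction N) {p q : ℝ}
    (hp : 0 < p) (hpq : p < q) (h : LowerGrowth N (Ioi 0) q) : orliczBeta N < 1 / p := by
  obtain ⟨C, hC, hG⟩ := h
  refine lt_of_le_of_lt ?_ (one_div_lt_one_div_of_lt hp hpq)
  refine le_of_tendsto_logb_iSup (C := C ^ (1 / q)) (fun k n => (orliczBeta_bounds hN k n).1)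
    (by positivity) (tendsto_orliczBeta hN) fun k n => ?_
  have := orliczInv_add_div_le hN (hp.trans hpq) hC hG (k := k - n)
    (orliczInv_pos hN (by positivity)) n
  rwa [sub_add_cancel] at this

theorem exists_lowerGrowth_of_orliczBetaZero_lt {N : ℝ → ℝ} (hN : IsOrliczFunction N) {p : ℝ}
    (hp : 0 < p) (h : orliczBetaZero N < 1 / p) :
    ∃ q, p < q ∧ LowerGrowth N (Ici (orliczInv N 1)) q := by
  obtain ⟨y, hy, hyp⟩ := exists_between (max_lt h (one_div_pos.2 hp))
  have hy0 : 0 < y := (le_max_right _ _).trans_lt hy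
  obtain ⟨C, hC, hr⟩ := exists_bound_of_tendsto_logb_iSup
    (r := fun (k : {k : ℤ // 0 ≤ k}) n =>
      orliczInv N (2 ^ ((k : ℤ) + (n : ℤ))) / orliczInv N (2 ^ (k : ℤ)))
    (fun n => ⟨2 ^ n, by rintro _ ⟨k, rfl⟩; exact (orliczBetaZero_bounds hN k n).2⟩)
    (fun (k : {k : ℤ // 0 ≤ k}) n => (orliczBetaZero_bounds hN k n).1) (tendsto_orliczBetaZero hN)
    ((le_max_left _ _).trans_lt hy)
  refine ⟨1 / y, (lt_one_div hp hy0).2 hyp, ?_⟩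
  obtain ⟨D, hD, hG⟩ := lowerGrowth_of_dyadic hN (K := {k | 0 ≤ k}) hC hy0
    fun k hk n => hr ⟨k, hk⟩ n
  have h1 := orliczInv_pos hN one_pos
  refine ⟨D, hD, fun s hs => hG s ⟨h1.trans_le hs, ?_⟩⟩
  have h2 := hN.mono h1.le hs
  rw [(orliczInv_spec hN zero_le_one).2] at h2
  have h3 := Int.log_mono_right (b := 2) one_pos h2
  rwa [Int.log_one_right] at h3

theorem orliczBetaZero_lt_of_lowerGrowth {N : ℝ → ℝ} (hN : IsOrliczFunction N) {p q : ℝ}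
    (hp : 0 < p) (hpq : p < q) (h : LowerGrowth N (Ici (orliczInv N 1)) q) :
    orliczBetaZero N < 1 / p := by
  obtain ⟨C, hC, hG⟩ := h
  refine lt_of_le_of_lt ?_ (one_div_lt_one_div_of_lt hp hpq)
  refine le_of_tendsto_logb_iSup (C := C ^ (1 / q)) (fun (k : {k : ℤ // 0 ≤ k}) n => (orliczBetaZero_bounds hN k n).1)
    (by positivity) (tendsto_orliczBetaZero hN) fun k n => ?_
  exact orliczInv_add_div_le hN (hp.trans hpq) hC hG
    (orliczInv_mono hN zero_le_one (one_le_zpow₀ one_le_two k.2)) n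

theorem exists_upperGrowth_of_lt_orliczAlpha {N : ℝ → ℝ} (hN : IsOrliczFunction N) {p : ℝ}
    (hp : 0 < p) (h : 1 / p < orliczAlpha N) :
    ∃ q, 0 < q ∧ q < p ∧ UpperGrowth N (Ioi 0) q := by
  obtain ⟨y, hyp, hy⟩ := exists_between h
  have hy0 : 0 < y := (one_div_pos.2 hp).trans hyp
  obtain ⟨C, hC, hr⟩ := exists_bound_of_tendsto_logb_iSup
    (fun n => ⟨1, by rintro _ ⟨k, rfl⟩; exact (orliczAlpha_bounds hN k n).2⟩)
    (fun k n => (orliczAlpha_bounds hN k n).1) (tendsto_orliczAlpha hN) (neg_lt_neg hy)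
  refine ⟨1 / y, one_div_pos.2 hy0, (one_div_lt hp hy0).1 hyp, ?_⟩
  obtain ⟨D, hD, hG⟩ := upperGrowth_of_dyadic hN (K := univ) hC hy0 fun k _ n => hr k n
  exact ⟨D, hD, fun s hs => hG s ⟨hs, trivial⟩⟩

theorem lt_orliczAlpha_of_upperGrowth {N : ℝ → ℝ} (hN : IsOrliczFunction N) {p q : ℝ}
    (hq : 0 < q) (hpq : q < p) (h : UpperGrowth N (Ioi 0) q) : 1 / p < orliczAlpha N := by
  obtain ⟨C, hC, hG⟩ := h
  refine (one_div_lt_one_div_of_lt hq hpq).trans_le (neg_le_neg_iff.1 ?_)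
  exact le_of_tendsto_logb_iSup (C := C ^ (1 / q)) (fun k n => (orliczAlpha_bounds hN k n).1)
    (by positivity) (tendsto_orliczAlpha hN) fun k n =>
      orliczInv_sub_div_le hN hq hC hG (orliczInv_pos hN (by positivity)) n

theorem exists_upperGrowth_of_lt_orliczAlphaInfty {N : ℝ → ℝ} (hN : IsOrliczFunction N) {p : ℝ}
    (hp : 0 < p) (h : 1 / p < orliczAlphaInfty N) :
    ∃ q, 0 < q ∧ q < p ∧ UpperGrowth N (Ioc 0 (orliczInv N 1)) q := by
  obtain ⟨y, hyp, hy⟩ := exists_between h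
  have hy0 : 0 < y := (one_div_pos.2 hp).trans hyp
  obtain ⟨C, hC, hr⟩ := exists_bound_of_tendsto_logb_iSup
    (r := fun (k : {k : ℤ // k ≤ 0}) n =>
      orliczInv N (2 ^ ((k : ℤ) - (n : ℤ))) / orliczInv N (2 ^ (k : ℤ)))
    (fun n => ⟨1, by rintro _ ⟨k, rfl⟩; exact (orliczAlpha_bounds hN k n).2⟩)
    (fun (k : {k : ℤ // k ≤ 0}) n => (orliczAlpha_bounds hN k n).1) (tendsto_orliczAlphaInfty hN) (neg_lt_neg hy)
  refine ⟨1 / y, one_div_pos.2 hy0, (one_div_lt hp hy0).1 hyp, ?_⟩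
  obtain ⟨D, hD, hG⟩ := upperGrowth_of_dyadic hN (K := {k | k ≤ 0}) hC hy0
    fun k hk n => hr ⟨k, hk⟩ n
  refine ⟨D, hD, fun s hs => hG s ⟨hs.1, ?_⟩⟩
  have h2 := hN.mono hs.1.le hs.2
  rw [(orliczInv_spec hN zero_le_one).2] at h2
  have h3 := Int.clog_mono_right (b := 2) (hN.pos hs.1) h2
  rwa [Int.clog_one_right] at h3

theorem lt_orliczAlphaInfty_of_upperGrowth {N : ℝ → ℝ} (hN : IsOrliczFunction N) {p q : ℝ}
    (hq : 0 < q) (hpq : q < p) (h : UpperGrowth N (Ioc 0 (orliczInv N 1)) q) :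
    1 / p < orliczAlphaInfty N := by
  obtain ⟨C, hC, hG⟩ := h
  refine (one_div_lt_one_div_of_lt hq hpq).trans_le (neg_le_neg_iff.1 ?_)
  exact le_of_tendsto_logb_iSup (C := C ^ (1 / q)) (fun (k : {k : ℤ // k ≤ 0}) n => (orliczAlpha_bounds hN k n).1)
    (by positivity) (tendsto_orliczAlphaInfty hN) fun k n =>
      orliczInv_sub_div_le hN hq hC hG ⟨orliczInv_pos hN (by positivity),
        orliczInv_mono hN (by positivity) (zpow_le_one_of_nonpos₀ one_le_two k.2)⟩ n

theorem orliczBeta_le_one {N : ℝ → ℝ} (hN : IsOrliczFunction N) : orliczBeta N ≤ 1 :=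
  le_of_tendsto_logb_iSup (C := 1) (fun k n => (orliczBeta_bounds hN k n).1) one_pos
    (tendsto_orliczBeta hN) fun k n => by
      simpa using (orliczBeta_bounds hN k n).2

theorem orliczAlpha_le_orliczAlphaInfty {N : ℝ → ℝ} (hN : IsOrliczFunction N) :
    orliczAlpha N ≤ orliczAlphaInfty N := by
  refine neg_le_neg_iff.1 (le_of_tendsto_of_tendsto' (tendsto_orliczAlphaInfty hN)
    (tendsto_orliczAlpha hN) fun n => ?_)
  have hb : BddAbove (range fun k : ℤ =>
      orliczInv N (2 ^ (k - (n : ℤ))) / orliczInv N (2 ^ k)) :=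
    ⟨1, by rintro _ ⟨k, rfl⟩; exact (orliczAlpha_bounds hN k n).2⟩
  have h0 : BddAbove (range fun k : {k : ℤ // k ≤ 0} =>
      orliczInv N (2 ^ ((k : ℤ) - (n : ℤ))) / orliczInv N (2 ^ (k : ℤ))) :=
    ⟨1, by rintro _ ⟨k, rfl⟩; exact (orliczAlpha_bounds hN k n).2⟩
  refine mul_le_mul_of_nonneg_left (Real.logb_le_logb_of_le one_lt_two ?_ ?_) (by positivity)
  · exact (orliczAlpha_bounds hN 0 n).1.trans_le (le_ciSup h0 ⟨0, le_rfl⟩)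
  · exact ciSup_le fun k => le_ciSup hb (k : ℤ)

theorem orliczBetaZero_le_orliczBeta {N : ℝ → ℝ} (hN : IsOrliczFunction N) :
    orliczBetaZero N ≤ orliczBeta N := by
  refine le_of_tendsto_of_tendsto' (tendsto_orliczBetaZero hN) (tendsto_orliczBeta hN) fun n => ?_
  have hb : BddAbove (range fun k : ℤ =>
      orliczInv N (2 ^ k) / orliczInv N (2 ^ (k - (n : ℤ)))) :=
    ⟨2 ^ n, by rintro _ ⟨k, rfl⟩; exact (orliczBeta_bounds hN k n).2⟩
  have h0 : BddAbove (range fun k : {k : ℤ // 0 ≤ k} =>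
      orliczInv N (2 ^ ((k : ℤ) + (n : ℤ))) / orliczInv N (2 ^ (k : ℤ))) :=
    ⟨2 ^ n, by rintro _ ⟨k, rfl⟩; exact (orliczBetaZero_bounds hN k n).2⟩
  refine mul_le_mul_of_nonneg_left (Real.logb_le_logb_of_le one_lt_two ?_ ?_) (by positivity)
  · exact (orliczBetaZero_bounds hN 0 n).1.trans_le (le_ciSup h0 ⟨0, le_rfl⟩)
  · refine ciSup_le fun k => ?_
    have := le_ciSup hb ((k : ℤ) + n)
    simpa only [add_sub_cancel_right] using this

theorem orliczAlpha_le_orliczBetaZero {N : ℝ → ℝ} (hN : IsOrliczFunction N) :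
    orliczAlpha N ≤ orliczBetaZero N := by
  have h := (tendsto_orliczBetaZero hN).add (tendsto_orliczAlpha hN)
  have h0 := ge_of_tendsto' h (b := 0) fun n => ?_
  · linarith
  have hb : BddAbove (range fun k : {k : ℤ // 0 ≤ k} =>
      orliczInv N (2 ^ ((k : ℤ) + (n : ℤ))) / orliczInv N (2 ^ (k : ℤ))) :=
    ⟨2 ^ n, by rintro _ ⟨k, rfl⟩; exact (orliczBetaZero_bounds hN k n).2⟩
  have ha : BddAbove (range fun k : ℤ =>
      orliczInv N (2 ^ (k - (n : ℤ))) / orliczInv N (2 ^ k)) :=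
    ⟨1, by rintro _ ⟨k, rfl⟩; exact (orliczAlpha_bounds hN k n).2⟩
  -- The ratios for `k = 0` in `β⁰` and for `k = n` in `α` are reciprocal, so the product of the two
  -- suprema is at least `1`.
  have h1 := le_ciSup hb ⟨0, le_rfl⟩
  have h2 := le_ciSup ha (n : ℤ)
  have h3 := (orliczBetaZero_bounds hN 0 n).1
  have h4 := (orliczAlpha_bounds hN n n).1
  rw [← mul_add, ← Real.logb_mul (h3.trans_le h1).ne' (h4.trans_le h2).ne']
  refine mul_nonneg (by positivity) (Real.logb_nonneg one_lt_two ?_)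
  refine le_trans (le_of_eq ?_) (mul_le_mul h1 h2 h4.le (h3.le.trans h1))
  have h5 := (orliczInv_pos hN (s := 2 ^ (n : ℤ)) (by positivity)).ne'
  have h6 := (orliczInv_pos hN (s := 2 ^ (0 : ℤ)) (by positivity)).ne'
  rw [zpow_zero] at h6
  simp only [zero_add, sub_self, zpow_zero]
  field_simp

/-! ### Bad exponents give steepness -/

/-- `t ↦ N t / t ^ p` is nowhere close to having a broad local maximum. -/
def SteepAround (N : ℝ → ℝ) (p : ℝ) : Prop :=
  ∀ B : ℝ, 0 < B → ∃ l : ℝ, 1 < l ∧ ∀ t, 0 < t →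
    B * N t ≤ l ^ (-p) * N (l * t) + l ^ p * N (t / l)

/-- The gap between the exponents contributes a factor `l ^ (q - p)`, which eventually exceeds `B *
C`. -/
theorem LowerGrowth.eventually_le {N : ℝ → ℝ} {S : Set ℝ} {p q : ℝ} (h : LowerGrowth N S q)
    (hS : S ⊆ Ioi 0) (hpq : p < q) (B : ℝ) :
    ∀ᶠ l in atTop, ∀ t ∈ S, N t ≥ 0 → B * N t ≤ l ^ (-p) * N (l * t) := by
  obtain ⟨C, hC, hG⟩ := h
  filter_upwards [(tendsto_rpow_atTop (sub_pos.2 hpq)).eventually_ge_atTop (B * C),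
    eventually_ge_atTop 1] with l hl hl1 t ht hNt
  have hl0 : 0 < l := by linarith
  have ht0 : 0 < t := hS ht
  have h1 := hG t ht (l * t) (le_mul_of_one_le_left ht0.le hl1)
  rw [mul_div_cancel_right₀ _ ht0.ne'] at h1
  refine le_of_mul_le_mul_left (a := C) ?_ hC
  calc C * (B * N t) = (B * C) * N t := by ring
    _ ≤ l ^ (q - p) * N t := by gcongr
    _ = l ^ (-p) * (l ^ q * N t) := by
      rw [← mul_assoc, ← Real.rpow_add hl0, neg_add_eq_sub]
    _ ≤ l ^ (-p) * (C * N (l * t)) := by gcongr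
    _ = _ := by ring

theorem UpperGrowth.eventually_le {N : ℝ → ℝ} {S : Set ℝ} {p q : ℝ} (h : UpperGrowth N S q)
    (hS : S ⊆ Ioi 0) (hpq : q < p) {B : ℝ} (hB : 0 < B) :
    ∀ᶠ l in atTop, ∀ t ∈ S, N (t / l) ≥ 0 → B * N t ≤ l ^ p * N (t / l) := by
  obtain ⟨C, hC, hG⟩ := h
  filter_upwards [(tendsto_rpow_atTop (sub_pos.2 hpq)).eventually_ge_atTop (B * C),
    eventually_ge_atTop 1] with l hl hl1 t ht hNt
  have hl0 : 0 < l := by linarith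
  have ht0 : 0 < t := hS ht
  have h1 := hG t ht (t / l) (by positivity) (div_le_self ht0.le hl1)
  rw [div_div_cancel₀ ht0.ne'] at h1
  calc B * N t ≤ B * (C * (l ^ q * N (t / l))) := by gcongr
    _ = (B * C) * (l ^ q * N (t / l)) := by ring
    _ ≤ l ^ (p - q) * (l ^ q * N (t / l)) := by gcongr
    _ = _ := by rw [← mul_assoc, ← Real.rpow_add hl0, sub_add_cancel]

/-- At each point one of the two dilated terms suffices. The nonemptiness guards let one region be
empty with a dummy exponent, so that the global cases and the mixed case share one argument. -/
theorem steepAround_of_cover {N : ℝ → ℝ} (hN : IsOrliczFunction N) {p q q' : ℝ} {S T : Set ℝ}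
    (hS : S ⊆ Ioi 0) (hT : T ⊆ Ioi 0) (hST : Ioi 0 ⊆ S ∪ T)
    (hlow : S.Nonempty → p < q ∧ LowerGrowth N S q)
    (hup : T.Nonempty → q' < p ∧ UpperGrowth N T q') : SteepAround N p := by
  intro B hB
  have h1 : ∀ᶠ l in atTop, ∀ t ∈ S, N t ≥ 0 → B * N t ≤ l ^ (-p) * N (l * t) := by
    rcases S.eq_empty_or_nonempty with rfl | h
    · simp
    · exact (hlow h).2.eventually_le hS (hlow h).1 B
  have h2 : ∀ᶠ l in atTop, ∀ t ∈ T, N (t / l) ≥ 0 → B * N t ≤ l ^ p * N (t / l) := by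
    rcases T.eq_empty_or_nonempty with rfl | h
    · simp
    · exact (hup h).2.eventually_le hT (hup h).1 hB
  obtain ⟨l, hl1, hl2, hl⟩ := (h1.and (h2.and (eventually_gt_atTop 1))).exists
  refine ⟨l, hl, fun t ht => ?_⟩
  have hl0 : 0 < l := by linarith
  have a1 := hN.nonneg (t := l * t) (by positivity)
  have a2 := hN.nonneg (t := t / l) (by positivity)
  have a3 := hN.nonneg (t := t) (by positivity)
  have a4 : 0 ≤ l ^ (-p) * N (l * t) := by positivity
  have a5 : 0 ≤ l ^ p * N (t / l) := by positivity
  rcases hST ht with h | h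
  · have := hl1 t h a3; linarith
  · have := hl2 t h a2; linarith

theorem steepAround_of_indices {N : ℝ → ℝ} (hN : IsOrliczFunction N) {p : ℝ} (hp : 0 < p)
    (h : orliczBeta N < 1 / p ∨ 1 / p < orliczAlpha N ∨
      (orliczBetaZero N < 1 / p ∧ 1 / p < orliczAlphaInfty N)) : SteepAround N p := by
  rcases h with h | h | ⟨h, h'⟩
  · obtain ⟨q, hq, hG⟩ := exists_lowerGrowth_of_orliczBeta_lt hN hp h
    exact steepAround_of_cover hN (q' := 0) (T := ∅) Subset.rfl (by simp) (by simp)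
      (fun _ => ⟨hq, hG⟩) (by simp)
  · obtain ⟨q, -, hq, hG⟩ := exists_upperGrowth_of_lt_orliczAlpha hN hp h
    exact steepAround_of_cover hN (q := 0) (S := ∅) (by simp) Subset.rfl (by simp)
      (by simp) (fun _ => ⟨hq, hG⟩)
  · obtain ⟨q, hq, hG⟩ := exists_lowerGrowth_of_orliczBetaZero_lt hN hp h
    obtain ⟨q', -, hq', hG'⟩ := exists_upperGrowth_of_lt_orliczAlphaInfty hN hp h'
    refine steepAround_of_cover hN (fun t ht => (orliczInv_pos hN one_pos).trans_le ht)
      (fun t ht => ht.1) (fun t ht => ?_) (fun _ => ⟨hq, hG⟩) (fun _ => ⟨hq', hG'⟩)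
    rcases le_total (orliczInv N 1) t with h1 | h1
    · exact Or.inl h1
    · exact Or.inr ⟨ht, h1⟩

/-! ### Modulars of disjoint sums -/

theorem IsOrliczFunction.continuous_comp_abs {N : ℝ → ℝ} (hN : IsOrliczFunction N) :
    Continuous fun t => N |t| :=
  hN.continuous.comp_continuous continuous_abs fun t => abs_nonneg t

theorem orlicz_apply_disjoint_sum {N : ℝ → ℝ} (hN : IsOrliczFunction N) {n : ℕ}
    {x : Fin n → ℝ} (hx : ∀ i j, i ≠ j → x i = 0 ∨ x j = 0) (a : Fin n → ℝ) (u : ℝ) :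
    ENNReal.ofReal (N (|∑ k, a k * x k| / u)) =
      ∑ k, ENNReal.ofReal (N (|a k| * |x k| / u)) := by
  by_cases h : ∃ i, x i ≠ 0
  · obtain ⟨i, hi⟩ := h
    have h0 : ∀ j, j ≠ i → x j = 0 := fun j hj => (hx i j hj.symm).resolve_left hi
    rw [Finset.sum_eq_single i (fun j _ hj => by rw [h0 j hj, mul_zero]) (by simp),
      Finset.sum_eq_single i (fun j _ hj => by simp [h0 j hj, hN.map_zero]) (by simp), abs_mul]
  · push Not at h
    simp [h, hN.map_zero]

theorem lintegral_orlicz_disjoint_sum {N : ℝ → ℝ} (hN : IsOrliczFunction N) {n : ℕ}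
    {x : Fin n → ℝ → ℝ} (hm : ∀ i, AEMeasurable (x i) halfLine)
    (hd : ∀ i j, i ≠ j → DisjointSupports (x i) (x j)) (a : Fin n → ℝ) {u : ℝ} (hu : 0 < u) :
    ∫⁻ t, ENNReal.ofReal (N (|∑ k, a k * x k t| / u)) ∂halfLine =
      ∑ k, ∫⁻ t, ENNReal.ofReal (N (|a k| / u * |x k t|)) ∂halfLine := by
  have hae : ∀ᵐ t ∂halfLine, ∀ i j, i ≠ j → x i t = 0 ∨ x j t = 0 := by
    rw [ae_all_iff]; intro i
    rw [ae_all_iff]; intro j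
    by_cases hij : i = j
    · simp [hij]
    · exact (hd i j hij).mono fun t ht _ => ht
  rw [← lintegral_finsetSum' _ fun k _ => ?_]
  · refine lintegral_congr_ae ?_
    filter_upwards [hae] with t ht
    rw [orlicz_apply_disjoint_sum hN ht]
    simp only [div_mul_eq_mul_div]
  · have : (fun t => ENNReal.ofReal (N (|a k| / u * |x k t|))) =
        fun t => ENNReal.ofReal (N |a k / u * x k t|) := by
      ext t; rw [abs_mul, abs_div, abs_of_pos hu]
    rw [this]
    exact (hN.continuous_comp_abs.measurable.comp_aemeasurable
      ((hm k).const_mul _)).ennreal_ofReal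

/-- By the layer cake formula the modular depends only on the distribution function, since
superlevel sets of `N (s |x|)` are superlevel sets of `|x|`. -/
theorem Equimeasurable.lintegral_orlicz_eq {N : ℝ → ℝ} (hN : IsOrliczFunction N) {x y : ℝ → ℝ}
    (hx : AEMeasurable x halfLine) (hy : AEMeasurable y halfLine) (h : Equimeasurable x y)
    {s : ℝ} (hs : 0 ≤ s) :
    ∫⁻ t, ENNReal.ofReal (N (s * |x t|)) ∂halfLine =
      ∫⁻ t, ENNReal.ofReal (N (s * |y t|)) ∂halfLine := by
  rcases hs.eq_or_lt with rfl | hs0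
  · simp [hN.map_zero]
  have hmeas : ∀ z : ℝ → ℝ, AEMeasurable z halfLine →
      AEMeasurable (fun t => N (s * |z t|)) halfLine := by
    intro z hz
    have : (fun t => N (s * |z t|)) = fun t => N |s * z t| := by
      ext t; rw [abs_mul, abs_of_nonneg hs]
    rw [this]
    exact hN.continuous_comp_abs.measurable.comp_aemeasurable (hz.const_mul _)
  have hnn : ∀ z : ℝ → ℝ, 0 ≤ᵐ[halfLine] fun t => N (s * |z t|) := fun z =>
    ae_of_all _ fun t => hN.nonneg (by positivity)
  rw [lintegral_eq_lintegral_meas_lt _ (hnn x) (hmeas x hx),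
    lintegral_eq_lintegral_meas_lt _ (hnn y) (hmeas y hy)]
  refine setLIntegral_congr_fun measurableSet_Ioi fun v hv => ?_
  have hv0 : 0 < v := hv
  have hset : ∀ z : ℝ → ℝ, {t | v < N (s * |z t|)} = {t | orliczInv N v / s < |z t|} := by
    intro z
    ext t
    simp only [mem_ofPred_eq]
    rw [div_lt_iff₀' hs0]
    conv_lhs => rw [← (orliczInv_spec hN hv0.le).2]
    exact hN.increasing.lt_iff_lt (mem_Ici.2 (orliczInv_spec hN hv0.le).1)
      (mem_Ici.2 (by positivity))
  simp only [hset]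
  exact h _ (div_pos (orliczInv_pos hN hv0) hs0)

theorem luxemburgSet_of_lt {N : ℝ → ℝ} (hN : IsOrliczFunction N) {x : ℝ → ℝ} {u : ℝ}
    (h0 : 0 < orliczNorm N x) (h : orliczNorm N x < u) :
    ∫⁻ t, ENNReal.ofReal (N (|x t| / u)) ∂halfLine ≤ 1 := by
  have hne : (luxemburgSet N x).Nonempty := by
    -- Positivity of the norm rules out the default value `sInf ∅ = 0`.
    by_contra hne
    rw [not_nonempty_iff_eq_empty] at hne
    rw [orliczNorm, hne, Real.sInf_empty] at h0
    exact lt_irrefl _ h0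
  obtain ⟨v, ⟨hv, hv1⟩, hvu⟩ := (csInf_lt_iff ⟨0, fun v hv => hv.1.le⟩ hne).1 h
  refine (lintegral_mono fun t => ENNReal.ofReal_le_ofReal (hN.mono
    (div_nonneg (abs_nonneg _) (hv.trans hvu).le) ?_)).trans hv1
  gcongr

theorem one_lt_lintegral_of_lt_orliczNorm {N : ℝ → ℝ} {x : ℝ → ℝ} {u : ℝ}
    (hu : 0 < u) (h : u < orliczNorm N x) :
    1 < ∫⁻ t, ENNReal.ofReal (N (|x t| / u)) ∂halfLine := by
  by_contra! h'
  exact h.not_ge (csInf_le ⟨0, fun v hv => hv.1.le⟩ ⟨hu, h'⟩)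

/-! ### Steepness excludes symmetric copies -/

/-- For a normalized copy of `ℓ^p`, the modular of the generating function at scale `1 / u`
is comparable to `1 / m`, where `u` is near the norm of a sum of `m` copies. -/
theorem SymmFinitelyRepresented.exists_modular {N : ℝ → ℝ} (hN : IsOrliczFunction N) {p : ℝ≥0∞}
    (h : SymmFinitelyRepresented N p) (n : ℕ) (hn : 0 < n) :
    ∃ x : ℝ → ℝ, AEMeasurable x halfLine ∧ ∀ (m : ℕ) (_ : m ≤ n) (ν : ℝ), 0 < ν →
      ‖WithLp.toLp p (fun k : Fin n => if (k : ℕ) < m then (1 : ℝ) else 0)‖ = ν → ∀ s : ℝ, 0 < s →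
      (s * (2 * ν) < 1 → (m : ℝ≥0∞) * ∫⁻ t, ENNReal.ofReal (N (s * |x t|)) ∂halfLine ≤ 1) ∧
      (2 * ν⁻¹ < s → 1 < (m : ℝ≥0∞) * ∫⁻ t, ENNReal.ofReal (N (s * |x t|)) ∂halfLine) := by
  obtain ⟨x, hx, he, hd, hnorm⟩ := h n 1 one_pos
  refine ⟨x ⟨0, hn⟩, (hx _).1, fun m hm ν hν hnu s hs => ?_⟩
  -- Taking `ε = 1` places the norm of a sum of `m` copies between `ν / 2` and `2 * ν`.
  have key := hnorm fun k : Fin n => if (k : ℕ) < m then (1 : ℝ) else 0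
  rw [hnu] at key
  have hu : 0 < 1 / s := by positivity
  have hsum := lintegral_orlicz_disjoint_sum hN (fun i => (hx i).1) hd
    (fun k : Fin n => if (k : ℕ) < m then (1 : ℝ) else 0) hu
  have hcount : ∑ k : Fin n, ∫⁻ t, ENNReal.ofReal
      (N (|if (k : ℕ) < m then (1 : ℝ) else 0| / (1 / s) * |x k t|)) ∂halfLine =
      (m : ℝ≥0∞) * ∫⁻ t, ENNReal.ofReal (N (s * |x ⟨0, hn⟩ t|)) ∂halfLine := by
    have : ∀ k : Fin n, ∫⁻ t, ENNReal.ofReal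
      (N (|if (k : ℕ) < m then (1 : ℝ) else 0| / (1 / s) * |x k t|)) ∂halfLine =
      if (k : ℕ) < m then ∫⁻ t, ENNReal.ofReal (N (s * |x ⟨0, hn⟩ t|)) ∂halfLine else 0 := by
      intro k
      split_ifs
      · rw [(he ⟨0, hn⟩ k).lintegral_orlicz_eq hN (hx _).1 (hx _).1 hs.le]
        simp
      · simp [hN.map_zero]
    rw [Finset.sum_congr rfl fun k _ => this k, ← Finset.sum_filter, Finset.sum_const,
      nsmul_eq_mul]
    congr 2
    rw [Fin.card_filter_val_lt, min_eq_right hm]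
  rw [hcount] at hsum
  rw [← hsum]
  constructor
  · intro h1
    refine luxemburgSet_of_lt hN (lt_of_lt_of_le (by positivity) key.1) (key.2.trans_lt ?_)
    rw [lt_div_iff₀ hs]; linarith
  · intro h1
    refine one_lt_lintegral_of_lt_orliczNorm hu (lt_of_lt_of_le ?_ key.1)
    rw [div_lt_iff₀ hs]
    rw [← div_eq_mul_inv, div_lt_iff₀ hν] at h1
    norm_num; linarith

theorem norm_toLp_indicator {n m : ℕ} (hm : m ≤ n) {p : ℝ≥0∞} (hp : 0 < p.toReal) :
    ‖WithLp.toLp p (fun k : Fin n => if (k : ℕ) < m then (1 : ℝ) else 0)‖ =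
      (m : ℝ) ^ (1 / p.toReal) := by
  rw [PiLp.norm_eq_sum hp]
  congr 1
  have : ∀ k : Fin n, ‖if (k : ℕ) < m then (1 : ℝ) else 0‖ ^ p.toReal =
      if (k : ℕ) < m then 1 else 0 := by
    intro k; split_ifs <;> simp [hp.ne']
  rw [Finset.sum_congr rfl fun k _ => this k, ← Finset.sum_filter, Finset.sum_const,
      Fin.card_filter_val_lt, min_eq_right hm]
  simp

/-- Integrating the steepness inequality compares the modular at scale `1 / (4 * l)` with those at
`1 / 4` and `1 / (4 * l ^ 2)`. Sums of `m2`, `1` and `m3` copies bound these below, above and above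
by constant multiples of the `P`-th powers of the scales, with constants independent of `l`. -/
theorem SteepAround.not_symmFinitelyRepresented {N : ℝ → ℝ} (hN : IsOrliczFunction N) {p : ℝ≥0∞}
    (hp : 0 < p.toReal) (h : SteepAround N p.toReal) : ¬ SymmFinitelyRepresented N p := by
  intro hF
  set P := p.toReal with hP
  -- With this factor the final inequality, multiplied by `l ^ P`, has left side above `7 / 2` and
  -- right side at most `1 + 2`.
  obtain ⟨l, hl, hst⟩ := h (7 * 8 ^ P) (by positivity)
  have hl0 : 0 < l := by linarith
  -- More than `(8 * l) ^ P` copies force modular above `1 / m2` at scale `1 / (4 * l)`, and at most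
  -- `l ^ (2 * P)` copies keep it at most `1 / m3` at scale `1 / (4 * l ^ 2)`. Rounding costs a
  -- factor `2` in each count.
  set m2 := ⌊(8 * l) ^ P⌋₊ + 1
  set m3 := ⌊l ^ (2 * P)⌋₊
  have hm2 : (8 * l) ^ P < m2 := by exact_mod_cast Nat.lt_floor_add_one _
  have hone2 : 1 ≤ (8 * l) ^ P := Real.one_le_rpow (by linarith) hp.le
  have hone3 : 1 ≤ l ^ (2 * P) := Real.one_le_rpow hl.le (by positivity)
  have hm2' : (m2 : ℝ) ≤ 2 * (8 * l) ^ P := by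
    have := Nat.floor_le (a := (8 * l) ^ P) (by positivity)
    simp only [m2]; push_cast; linarith
  have hm3 : (m3 : ℝ) ≤ l ^ (2 * P) := Nat.floor_le (by positivity)
  have hm3' : l ^ (2 * P) ≤ 2 * m3 := by
    have h1 := Nat.lt_floor_add_one (l ^ (2 * P))
    have h2 : 1 ≤ m3 := Nat.le_floor (by exact_mod_cast hone3)
    have h2' : (1 : ℝ) ≤ m3 := by exact_mod_cast h2
    linarith
  have hm30 : (0 : ℝ) < m3 := by linarith
  have hm20 : (0 : ℝ) < m2 := by linarith
  obtain ⟨x, hx, hmod⟩ := hF.exists_modular hN (m2 + m3) (by omega)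
  set Φ : ℝ → ℝ≥0∞ := fun s => ∫⁻ t, ENNReal.ofReal (N (s * |x t|)) ∂halfLine with hΦ
  have hroot : ∀ y : ℝ, 0 ≤ y → (y ^ P) ^ (1 / P) = y := fun y hy => by
    rw [← Real.rpow_mul hy, mul_one_div_cancel hp.ne', Real.rpow_one]
  have e1 : Φ (1 / 4) ≤ 1 := by
    have := (hmod 1 (by omega) 1 one_pos
      (by rw [norm_toLp_indicator (by omega) hp]; simp) (1 / 4) (by norm_num)).1 (by norm_num)
    simpa using this
  have e3 : (m3 : ℝ≥0∞) * Φ (1 / (4 * l) / l) ≤ 1 := by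
    refine (hmod m3 (by omega) _ (by positivity)
      (norm_toLp_indicator (by omega) hp) _ (by positivity)).1 ?_
    have : (m3 : ℝ) ^ (1 / P) ≤ l ^ 2 := by
      calc (m3 : ℝ) ^ (1 / P) ≤ (l ^ (2 * P)) ^ (1 / P) :=
            Real.rpow_le_rpow hm30.le hm3 (by positivity)
        _ = ((l ^ 2) ^ P) ^ (1 / P) := by rw [Real.rpow_mul hl0.le, Real.rpow_two]
        _ = l ^ 2 := hroot _ (by positivity)
    calc 1 / (4 * l) / l * (2 * (m3 : ℝ) ^ (1 / P)) ≤ 1 / (4 * l) / l * (2 * l ^ 2) := by gcongr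
      _ = 1 / 2 := by field_simp; norm_num
      _ < 1 := by norm_num
  have e2 : 1 < (m2 : ℝ≥0∞) * Φ (1 / (4 * l)) := by
    refine (hmod m2 (by omega) _ (by positivity)
      (norm_toLp_indicator (by omega) hp) _ (by positivity)).2 ?_
    have : 8 * l < (m2 : ℝ) ^ (1 / P) := by
      calc 8 * l = ((8 * l) ^ P) ^ (1 / P) := (hroot _ (by positivity)).symm
        _ < _ := Real.rpow_lt_rpow (by positivity) hm2 (by positivity)
    rw [← div_eq_mul_inv, div_lt_div_iff₀ (by positivity) (by positivity)]
    linarith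
  have hlxm : ∀ s : ℝ, 0 ≤ s → AEMeasurable (fun t => ENNReal.ofReal (N (s * |x t|))) halfLine := by
    intro s hs
    have : (fun t => ENNReal.ofReal (N (s * |x t|))) = fun t => ENNReal.ofReal (N |s * x t|) := by
      ext t; rw [abs_mul, abs_of_nonneg hs]
    rw [this]
    exact (hN.continuous_comp_abs.measurable.comp_aemeasurable (hx.const_mul _)).ennreal_ofReal
  have e4 : ENNReal.ofReal (7 * 8 ^ P) * Φ (1 / (4 * l)) ≤
      ENNReal.ofReal (l ^ (-P)) * Φ (1 / 4) + ENNReal.ofReal (l ^ P) * Φ (1 / (4 * l) / l) := by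
    simp only [hΦ]
    rw [← lintegral_const_mul'' _ (hlxm _ (by positivity)),
      ← lintegral_const_mul'' _ (hlxm _ (by positivity)),
      ← lintegral_const_mul'' _ (hlxm _ (by positivity)),
      ← lintegral_add_left' ((hlxm _ (by positivity)).const_mul _)]
    refine lintegral_mono fun t => ?_
    have n1 := hN.nonneg (t := 1 / 4 * |x t|) (by positivity)
    have n2 := hN.nonneg (t := 1 / (4 * l) / l * |x t|) (by positivity)
    rw [← ENNReal.ofReal_mul (by positivity), ← ENNReal.ofReal_mul (by positivity),
      ← ENNReal.ofReal_mul (by positivity), ← ENNReal.ofReal_add (by positivity) (by positivity)]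
    refine ENNReal.ofReal_le_ofReal ?_
    rcases (abs_nonneg (x t)).eq_or_lt with h0 | h0
    · simp [← h0, hN.map_zero]
    · have := hst (1 / (4 * l) * |x t|) (by positivity)
      convert this using 4
      · field_simp
      · field_simp
  have f3 : Φ (1 / (4 * l) / l) ≠ ⊤ := by
    intro h0
    rw [h0, ENNReal.mul_top (by exact_mod_cast hm30.ne')] at e3
    simp at e3
  have f1 : Φ (1 / 4) ≠ ⊤ := ne_top_of_le_ne_top ENNReal.one_ne_top e1
  have f2 : Φ (1 / (4 * l)) ≠ ⊤ := by
    refine ne_top_of_le_ne_top f1 (lintegral_mono fun t =>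
      ENNReal.ofReal_le_ofReal (hN.mono (by positivity) ?_))
    gcongr
    linarith
  rw [← ENNReal.ofReal_toReal f1] at e1 e4
  rw [← ENNReal.ofReal_toReal f2] at e2 e4
  rw [← ENNReal.ofReal_toReal f3] at e3 e4
  rw [← ENNReal.ofReal_natCast, ← ENNReal.ofReal_mul (by positivity)] at e2 e3
  rw [← ENNReal.ofReal_mul (by positivity), ← ENNReal.ofReal_mul (by positivity),
    ← ENNReal.ofReal_mul (by positivity), ← ENNReal.ofReal_add (by positivity) (by positivity),
    ENNReal.ofReal_le_ofReal_iff (by positivity)] at e4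
  rw [ENNReal.ofReal_le_one] at e1 e3
  rw [ENNReal.one_lt_ofReal] at e2
  generalize (Φ (1 / 4)).toReal = A at *
  generalize (Φ (1 / (4 * l))).toReal = B at *
  generalize (Φ (1 / (4 * l) / l)).toReal = D at *
  have hlP : 0 < l ^ P := by positivity
  have h8 : 0 < (8 : ℝ) ^ P := by positivity
  rw [Real.rpow_neg hl0.le] at e4
  rw [Real.mul_rpow (by norm_num) hl0.le] at hm2 hm2'
  have hll : l ^ (2 * P) = l ^ P * l ^ P := by rw [two_mul, Real.rpow_add hl0]
  rw [hll] at hm3'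
  have hB : 0 < B := by
    by_contra! hB
    nlinarith
  have g2 : 1 < 2 * (8 ^ P * l ^ P) * B := by nlinarith
  have hD : D * (l ^ P * l ^ P) ≤ 2 := by
    rcases le_total D 0 with h0 | h0
    · have : D * (l ^ P * l ^ P) ≤ 0 := mul_nonpos_of_nonpos_of_nonneg h0 (by positivity)
      linarith
    · nlinarith
  have g4 : 7 * 8 ^ P * B * l ^ P ≤ A + D * (l ^ P * l ^ P) := by
    calc 7 * 8 ^ P * B * l ^ P ≤ ((l ^ P)⁻¹ * A + l ^ P * D) * l ^ P := by gcongr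
      _ = _ := by field_simp
  linarith

/-- In a copy of `ℓ^∞` one function has modular above `1` at scale `3`, while `n` of them together
stay at most `1` at scale `1 / 4`. Power growth bounds the ratio of the two modulars by `C * 12 ^
q`, whatever `n` is. -/
theorem UpperGrowth.not_symmFinitelyRepresented_top {N : ℝ → ℝ} (hN : IsOrliczFunction N) {q : ℝ}
    (h : UpperGrowth N (Ioi 0) q) : ¬ SymmFinitelyRepresented N ∞ := by
  intro hF
  obtain ⟨C, hC, hG⟩ := h
  obtain ⟨n, hn⟩ := exists_nat_gt (C * 12 ^ q)
  have hn0 : (0 : ℝ) < n := lt_of_le_of_lt (by positivity) hn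
  have hn1 : 0 < n := by exact_mod_cast hn0
  obtain ⟨x, hx, hmod⟩ := hF.exists_modular hN n hn1
  have hnorm : ∀ m, 0 < m → 
      ‖WithLp.toLp ∞ (fun k : Fin n => if (k : ℕ) < m then (1 : ℝ) else 0)‖ = 1 := by
    intro m hm
    have : Nonempty (Fin n) := ⟨⟨0, hn1⟩⟩
    rw [PiLp.norm_eq_ciSup]
    refine le_antisymm (ciSup_le fun k => ?_) ?_
    · simp only; split_ifs <;> simp
    · refine le_trans ?_ (le_ciSup (Set.finite_range _).bddAbove (⟨0, hn1⟩ : Fin n))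
      simp [hm]
  have e1 := (hmod 1 hn1 1 one_pos (hnorm 1 one_pos) 3 (by norm_num)).2 (by norm_num)
  have e2 := (hmod n le_rfl 1 one_pos (hnorm n hn1) (1 / 4) (by norm_num)).1 (by norm_num)
  have e3 : ∫⁻ t, ENNReal.ofReal (N (3 * |x t|)) ∂halfLine ≤
      ENNReal.ofReal (C * 12 ^ q) * ∫⁻ t, ENNReal.ofReal (N (1 / 4 * |x t|)) ∂halfLine := by
    rw [← lintegral_const_mul' _ _ ENNReal.ofReal_ne_top]
    refine lintegral_mono fun t => ?_
    rw [← ENNReal.ofReal_mul (by positivity)]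
    refine ENNReal.ofReal_le_ofReal ?_
    rcases (abs_nonneg (x t)).eq_or_lt with h0 | h0
    · simp [← h0, hN.map_zero]
    · have := hG (3 * |x t|) (mem_Ioi.2 (by positivity)) (1 / 4 * |x t|) (by positivity)
        (by linarith)
      rw [mul_div_mul_right _ _ h0.ne'] at this
      norm_num at this ⊢
      linarith
  refine absurd e2 (not_le.2 ?_)
  rw [Nat.cast_one, one_mul] at e1
  refine e1.trans_le (e3.trans ?_)
  gcongr
  rw [← ENNReal.ofReal_natCast]
  exact ENNReal.ofReal_le_ofReal hn.le

/-! ### Broad windows produce symmetric copies -/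

/-- The decreasing function `r ↦ N (r ^ (-1 / p))` has arbitrarily broad windows outside which it
carries little mass, relative to dilations. -/
def HasBroadWindows (N : ℝ → ℝ) (p : ℝ) : Prop :=
  ∀ L ε : ℝ, 1 < L → 0 < ε → ∃ A B : ℝ, 0 < A ∧ A < B ∧
    (∫ r in A..L * A, N (r ^ (-(1 / p)))) + ∫ r in B..L * B, N (r ^ (-(1 / p))) ≤
      ε * ∫ r in A..B, N (r ^ (-(1 / p)))

theorem IsOrliczFunction.continuousOn_comp_rpow {N : ℝ → ℝ} (hN : IsOrliczFunction N) {s : ℝ}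
    (hs : 0 ≤ s) (q : ℝ) : ContinuousOn (fun r => N (s * r ^ q)) (Ioi 0) := by
  refine hN.continuous.comp (continuousOn_const.mul fun r hr => ?_)
    fun r hr => mem_Ici.2 (mul_nonneg hs (Real.rpow_nonneg (le_of_lt hr) _))
  exact (Real.continuousAt_rpow_const r q (Or.inl (ne_of_gt hr))).continuousWithinAt

theorem IsOrliczFunction.intervalIntegrable {N : ℝ → ℝ} (hN : IsOrliczFunction N) {s : ℝ}
    (hs : 0 ≤ s) (q : ℝ) {a b : ℝ} (ha : 0 < a) (hb : 0 < b) :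
    IntervalIntegrable (fun r => N (s * r ^ q)) volume a b :=
  ((hN.continuousOn_comp_rpow hs q).mono fun _ hr =>
    (lt_min ha hb).trans_le hr.1).intervalIntegrable

theorem IsOrliczFunction.intervalIntegrable_one {N : ℝ → ℝ} (hN : IsOrliczFunction N)
    (q : ℝ) {a b : ℝ} (ha : 0 < a) (hb : 0 < b) :
    IntervalIntegrable (fun r => N (r ^ q)) volume a b := by
  simpa using hN.intervalIntegrable zero_le_one q ha hb

theorem IsOrliczFunction.integral_pos {N : ℝ → ℝ} (hN : IsOrliczFunction N)
    (q : ℝ) {a b : ℝ} (ha : 0 < a) (hab : a < b) : 0 < ∫ r in a..b, N (r ^ q) :=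
  intervalIntegral.intervalIntegral_pos_of_pos_on
    (hN.intervalIntegrable_one q ha (ha.trans hab))
    (fun _ hr => hN.pos (Real.rpow_pos_of_pos (ha.trans hr.1) _)) hab

theorem IsOrliczFunction.integral_mono_right {N : ℝ → ℝ} (hN : IsOrliczFunction N)
    (q : ℝ) {a b c : ℝ} (ha : 0 < a) (hab : a ≤ b) (hbc : b ≤ c) :
    0 ≤ ∫ r in a..b, N (r ^ q) ∧ ∫ r in a..b, N (r ^ q) ≤ ∫ r in a..c, N (r ^ q) := by
  have hnn : ∀ x y : ℝ, 0 < x → x ≤ y → 0 ≤ ∫ r in x..y, N (r ^ q) := fun x y hx hxy =>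
    intervalIntegral.integral_nonneg hxy fun r hr =>
      hN.nonneg (Real.rpow_nonneg (hx.le.trans hr.1) _)
  have hb := ha.trans_le hab
  rw [← intervalIntegral.integral_add_adjacent_intervals
    (hN.intervalIntegrable_one q ha hb) (hN.intervalIntegrable_one q hb (hb.trans_le hbc))]
  exact ⟨hnn a b ha hab, le_add_of_nonneg_right (hnn b c hb hbc)⟩

/-- Substituting `r ↦ s ^ (-p) * r` turns the scaled integral into `s ^ p` times the integral over a
dilated window. For `s ^ p ≥ 1 / L` the two windows differ only by end pieces of negligible mass;
smaller scales follow by monotonicity. -/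
theorem HasBroadWindows.exists_profile {N : ℝ → ℝ} (hN : IsOrliczFunction N) {p : ℝ} (hp : 0 < p)
    (h : HasBroadWindows N p) {δ : ℝ} (hδ : 0 < δ) :
    ∃ A B : ℝ, 0 < A ∧ A < B ∧ ∀ s : ℝ, 0 ≤ s → s ≤ 1 →
      |(∫ r in A..B, N (s * r ^ (-(1 / p)))) - s ^ p * ∫ r in A..B, N (r ^ (-(1 / p)))| ≤
        δ * ∫ r in A..B, N (r ^ (-(1 / p))) := by
  set L : ℝ := max 2 (2 / δ) with hL
  have hL1 : 1 < L := lt_of_lt_of_le one_lt_two (le_max_left _ _)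
  have hL0 : 0 < L := by linarith
  have hLδ : L⁻¹ ≤ δ / 2 := by
    rw [inv_le_comm₀ hL0 (by positivity), inv_div]
    exact le_max_right _ _
  obtain ⟨A, B, hA, hAB, hw⟩ := h L (δ / 2) hL1 (by positivity)
  have hB := hA.trans hAB
  refine ⟨A, B, hA, hAB, ?_⟩
  set I := ∫ r in A..B, N (r ^ (-(1 / p)))
  have hI : 0 < I := hN.integral_pos _ hA hAB
  have hbig : ∀ s : ℝ, 0 < s → s ≤ 1 → L⁻¹ ≤ s ^ p →
      |(∫ r in A..B, N (s * r ^ (-(1 / p)))) - s ^ p * I| ≤ δ / 2 * I := by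
    intro s hs hs1 hsL
    have hsp : 0 < s ^ p := by positivity
    have hsp1 : s ^ p ≤ 1 := Real.rpow_le_one hs.le hs1 hp.le
    set c := (s ^ p)⁻¹ with hc
    have hc1 : 1 ≤ c := (one_le_inv₀ hsp).2 hsp1
    have hcL : c ≤ L := inv_le_of_inv_le₀ hL0 hsL
    have hc0 : 0 < c := by positivity
    have hsub : ∫ r in A..B, N (s * r ^ (-(1 / p))) =
        s ^ p * ∫ r in c * A..c * B, N (r ^ (-(1 / p))) := by
      have h1 := intervalIntegral.integral_comp_mul_left (a := A) (b := B)
        (fun r => N (r ^ (-(1 / p)))) hc0.ne'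
      rw [hc, inv_inv, ← hc, smul_eq_mul] at h1
      rw [← h1]
      refine intervalIntegral.integral_congr fun r hr => ?_
      have hr0 : 0 < r := (lt_min hA hB).trans_le hr.1
      rw [Real.mul_rpow hc0.le hr0.le, hc, ← Real.rpow_neg hs.le, ← Real.rpow_mul hs.le]
      congr 2
      rw [show -p * -(1 / p) = 1 by field_simp, Real.rpow_one]
    have hsplit : ∫ r in c * A..c * B, N (r ^ (-(1 / p))) =
        I + (∫ r in B..c * B, N (r ^ (-(1 / p)))) - ∫ r in A..c * A, N (r ^ (-(1 / p))) := by
      have i1 := intervalIntegral.integral_add_adjacent_intervals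
        (hN.intervalIntegrable_one (-(1 / p)) hA hB)
        (hN.intervalIntegrable_one (-(1 / p)) hB (mul_pos hc0 hB))
      have i2 := intervalIntegral.integral_add_adjacent_intervals
        (hN.intervalIntegrable_one (-(1 / p)) hA (mul_pos hc0 hA))
        (hN.intervalIntegrable_one (-(1 / p)) (mul_pos hc0 hA) (mul_pos hc0 hB))
      linarith
    have hmA := hN.integral_mono_right (-(1 / p)) hA (le_mul_of_one_le_left hA.le hc1)
      (mul_le_mul_of_nonneg_right hcL hA.le)
    have hmB := hN.integral_mono_right (-(1 / p)) hB (le_mul_of_one_le_left hB.le hc1)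
      (mul_le_mul_of_nonneg_right hcL hB.le)
    rw [hsub, hsplit, ← mul_sub, abs_mul, abs_of_pos hsp]
    refine (mul_le_of_le_one_left (abs_nonneg _) hsp1).trans ?_
    rw [abs_le]
    constructor <;> linarith [hmA.1, hmA.2, hmB.1, hmB.2]
  intro s hs hs1
  rcases le_or_gt L⁻¹ (s ^ p) with h1 | h1
  · have hs0 : 0 < s := by
      rcases hs.eq_or_lt with h0 | h0
      · rw [← h0, Real.zero_rpow hp.ne'] at h1
        exact absurd h1 (not_le.2 (by positivity))
      · exact h0
    refine (hbig s hs0 hs1 h1).trans ?_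
    gcongr; linarith
  · set s0 := (L⁻¹) ^ (1 / p) with hs0
    have hs0p : s0 ^ p = L⁻¹ := by
      rw [hs0, ← Real.rpow_mul (by positivity), one_div_mul_cancel hp.ne', Real.rpow_one]
    have hs01 : s0 ≤ 1 :=
      Real.rpow_le_one (by positivity) (inv_le_one_of_one_le₀ hL1.le) (by positivity)
    have hss0 : s ≤ s0 := by
      rw [← Real.rpow_le_rpow_iff hs (by positivity) hp, hs0p]; exact h1.le
    have h2 := hbig s0 (by positivity) hs01 hs0p.ge
    have h3 : ∫ r in A..B, N (s * r ^ (-(1 / p))) ≤ ∫ r in A..B, N (s0 * r ^ (-(1 / p))) := by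
      refine intervalIntegral.integral_mono_on hAB.le (hN.intervalIntegrable hs _ hA hB)
        (hN.intervalIntegrable (by positivity) _ hA hB) fun r hr => ?_
      have hr0 : 0 < r := hA.trans_le hr.1
      exact hN.mono (by positivity) (by gcongr)
    have h4 : 0 ≤ ∫ r in A..B, N (s * r ^ (-(1 / p))) :=
      intervalIntegral.integral_nonneg hAB.le fun r hr =>
        hN.nonneg (mul_nonneg hs (Real.rpow_nonneg (hA.le.trans hr.1) _))
    have h5 : 0 ≤ s ^ p := by positivity
    rw [hs0p, abs_le] at h2
    have h6 : L⁻¹ * I ≤ δ / 2 * I := by gcongr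
    have h7 : s ^ p * I ≤ L⁻¹ * I := by gcongr
    have h8 : 0 ≤ s ^ p * I := by positivity
    rw [abs_le]
    constructor <;> linarith [h2.1, h2.2]

/-- Translates of a dilated truncated power function. -/
noncomputable def powerBump (p A B I : ℝ) (i : ℕ) (t : ℝ) : ℝ :=
  (Ioc A B).indicator (fun r => r ^ (-(1 / p))) (I * t - i * B)

theorem powerBump_measurable (p A B I : ℝ) (i : ℕ) : Measurable (powerBump p A B I i) :=
  ((measurable_id.pow_const _).indicator measurableSet_Ioc).comp (by fun_prop)

theorem powerBump_disjoint {p A B I : ℝ} (hA : 0 < A) (hAB : A < B) {i j : ℕ} (hij : i ≠ j) (t : ℝ) :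
    powerBump p A B I i t = 0 ∨ powerBump p A B I j t = 0 := by
  by_contra! h
  have h1 := mem_of_indicator_ne_zero h.1
  have h2 := mem_of_indicator_ne_zero h.2
  have hB := hA.trans hAB
  have key : ∀ i j : ℕ, i < j → I * t - i * B ∈ Ioc A B → I * t - j * B ∈ Ioc A B → False := by
    intro i j hij h1 h2
    have h3 : (i : ℝ) + 1 ≤ j := by exact_mod_cast hij
    have := mul_le_mul_of_nonneg_right h3 hB.le
    linarith [h1.1, h1.2, h2.1, h2.2]
  rcases lt_or_gt_of_ne hij with h | h
  · exact key i j h h1 h2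
  · exact key j i h h2 h1

/-- Every bump lives in the positive half-line, so with `φ 0 = 0` the integral may be taken over all
of `ℝ`, where translation and scaling apply. The result is independent of `i`, which also yields
equimeasurability. -/
theorem lintegral_powerBump {p A B I : ℝ} (hA : 0 < A) (hAB : A < B) (hI : 0 < I) (i : ℕ)
    {φ : ℝ → ℝ≥0∞} (hφ : Measurable φ) (h0 : φ 0 = 0) :
    ∫⁻ t, φ (powerBump p A B I i t) ∂halfLine =
      ENNReal.ofReal I⁻¹ * ∫⁻ r in Ioc A B, φ (r ^ (-(1 / p))) := by
  set f : ℝ → ℝ := (Ioc A B).indicator fun r => r ^ (-(1 / p)) with hf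
  have hfm : Measurable f := (measurable_id.pow_const _).indicator measurableSet_Ioc
  have hB := hA.trans hAB
  have h1 : ∫⁻ t, φ (powerBump p A B I i t) ∂halfLine = ∫⁻ t, φ (f (I * t - i * B)) := by
    rw [halfLine, ← lintegral_indicator measurableSet_Ioi]
    refine lintegral_congr fun t => ?_
    by_cases ht : t ∈ Ioi (0 : ℝ)
    · rw [indicator_of_mem ht]; rfl
    · rw [indicator_of_notMem ht, hf, indicator_of_notMem, h0]
      rintro ⟨h2, -⟩
      have h3 : t ≤ 0 := not_lt.1 ht
      have h4 : I * t ≤ 0 := mul_nonpos_of_nonneg_of_nonpos hI.le h3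
      have h5 : 0 ≤ (i : ℝ) * B := by positivity
      linarith
  rw [h1]
  have h2 : ∫⁻ t, φ (f (I * t - i * B)) = ∫⁻ t, φ (f (t - i * B)) ∂(volume.map (I * ·)) := by
    rw [lintegral_map (f := fun t => φ (f (t - i * B)))
      (hφ.comp (hfm.comp (measurable_id.sub_const _))) (measurable_const_mul I)]
  rw [h2, Real.map_volume_mul_left hI.ne', lintegral_smul_measure,
    lintegral_sub_right_eq_self (fun t => φ (f t)), abs_of_pos (inv_pos.2 hI), smul_eq_mul,
    ← lintegral_indicator measurableSet_Ioc]
  congr 1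
  refine lintegral_congr fun r => ?_
  by_cases hr : r ∈ Ioc A B
  · rw [indicator_of_mem hr, hf, indicator_of_mem hr]
  · rw [indicator_of_notMem hr, hf, indicator_of_notMem hr, h0]

theorem lintegral_orlicz_powerBump {N : ℝ → ℝ} (hN : IsOrliczFunction N) {p A B I : ℝ}
    (hA : 0 < A) (hAB : A < B) (hI : 0 < I) (i : ℕ) {s : ℝ} (hs : 0 ≤ s) :
    ∫⁻ t, ENNReal.ofReal (N (s * |powerBump p A B I i t|)) ∂halfLine =
      ENNReal.ofReal (I⁻¹ * ∫ r in A..B, N (s * r ^ (-(1 / p)))) := by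
  have hB := hA.trans hAB
  have hm : Measurable fun y : ℝ => ENNReal.ofReal (N (s * |y|)) := by
    have : (fun y : ℝ => N (s * |y|)) = fun y => N |s * y| := by
      ext y; rw [abs_mul, abs_of_nonneg hs]
    have h := hN.continuous_comp_abs.measurable.comp (measurable_const_mul s)
    refine Measurable.ennreal_ofReal ?_
    rw [this]
    exact h
  rw [lintegral_powerBump hA hAB hI i hm (by simp [hN.map_zero]),
    ENNReal.ofReal_mul (by positivity), intervalIntegral.integral_of_le hAB.le,
    ofReal_integral_eq_lintegral_ofReal]
  · congr 1
    refine setLIntegral_congr_fun measurableSet_Ioc fun r hr => ?_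
    rw [abs_of_pos (Real.rpow_pos_of_pos (hA.trans hr.1) _)]
  · exact (intervalIntegrable_iff_integrableOn_Ioc_of_le hAB.le).1
      (hN.intervalIntegrable hs _ hA hB)
  · refine (ae_restrict_iff' measurableSet_Ioc).2 (ae_of_all _ fun r hr => ?_)
    exact hN.nonneg (mul_nonneg hs (Real.rpow_nonneg (hA.trans hr.1).le _))

theorem powerBump_equimeasurable {p A B I : ℝ} (hA : 0 < A) (hAB : A < B) (hI : 0 < I) (i j : ℕ) :
    Equimeasurable (powerBump p A B I i) (powerBump p A B I j) := by
  intro τ hτ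
  have hS : MeasurableSet {y : ℝ | τ < |y|} := measurableSet_lt measurable_const (by fun_prop)
  have key : ∀ k : ℕ, halfLine {s | τ < |powerBump p A B I k s|} =
      ∫⁻ t, {y : ℝ | τ < |y|}.indicator 1 (powerBump p A B I k t) ∂halfLine := fun k => by
    exact (lintegral_indicator_one (powerBump_measurable p A B I k hS)).symm
  have hm : Measurable ({y : ℝ | τ < |y|}.indicator (1 : ℝ → ℝ≥0∞)) :=
    measurable_one.indicator hS
  have h0 : {y : ℝ | τ < |y|}.indicator (1 : ℝ → ℝ≥0∞) 0 = 0 :=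
    indicator_of_notMem (by simp [hτ.le]) _
  rw [key, key, lintegral_powerBump hA hAB hI i hm h0, lintegral_powerBump hA hAB hI j hm h0]

theorem IsOrliczFunction.map_mul_le {N : ℝ → ℝ} (hN : IsOrliczFunction N) {c t : ℝ} (hc : 0 ≤ c)
    (hc1 : c ≤ 1) (ht : 0 ≤ t) : N (c * t) ≤ c * N t := by
  have := hN.convex.2 (mem_Ici.2 ht) (mem_Ici.2 le_rfl) hc (sub_nonneg.2 hc1) (by ring)
  simpa [hN.map_zero] using this

/-- The bumps have modular nearly `s ^ P` for all scales in `[0, 1]`, so at `u = ‖a‖` the modular of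
the sum is within `η` of `1`. Convexity, as `Φ (c * s) ≤ c * Φ s`, turns this into an error in the
norm. -/
theorem HasBroadWindows.symmFinitelyRepresented {N : ℝ → ℝ} (hN : IsOrliczFunction N) {p : ℝ≥0∞}
    (hp : 0 < p.toReal) (h : HasBroadWindows N p.toReal) : SymmFinitelyRepresented N p := by
  intro n ε hε
  set P := p.toReal with hP
  -- Small enough for both `1 + η ≤ 1 + ε` and `(1 + ε)⁻¹ < 1 - η`.
  set η := ε / (2 * (1 + ε)) with hη
  have hη0 : 0 < η := by positivity
  -- The tolerance makes `n` errors add up to at most `η`; `n + 1` covers `n = 0`.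
  obtain ⟨A, B, hA, hAB, hprof⟩ := h.exists_profile hN hp (δ := η / (n + 1)) (by positivity)
  set I := ∫ r in A..B, N (r ^ (-(1 / P)))
  have hB := hA.trans hAB
  have hI : 0 < I := hN.integral_pos _ hA hAB
  set Φ : ℝ → ℝ := fun s => I⁻¹ * ∫ r in A..B, N (s * r ^ (-(1 / P))) with hΦ
  have hΦ0 : ∀ s, 0 ≤ s → 0 ≤ Φ s := fun s hs => mul_nonneg (by positivity)
    (intervalIntegral.integral_nonneg hAB.le fun r hr =>
      hN.nonneg (mul_nonneg hs (Real.rpow_nonneg (hA.le.trans hr.1) _)))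
  have hΦ1 : ∀ s, 0 ≤ s → s ≤ 1 → |Φ s - s ^ P| ≤ η / (n + 1) := by
    intro s hs hs1
    have h1 := hprof s hs hs1
    have h2 : Φ s - s ^ P = I⁻¹ * ((∫ r in A..B, N (s * r ^ (-(1 / P)))) - s ^ P * I) := by
      rw [mul_sub, mul_comm (s ^ P), inv_mul_cancel_left₀ hI.ne']
    rw [h2, abs_mul, abs_of_pos (inv_pos.2 hI), inv_mul_le_iff₀ hI]
    linarith
  have hΦc : ∀ c s, 0 ≤ c → c ≤ 1 → 0 ≤ s → Φ (c * s) ≤ c * Φ s := by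
    intro c s hc hc1 hs
    simp only [hΦ]
    rw [mul_left_comm c]
    refine mul_le_mul_of_nonneg_left ?_ (by positivity)
    rw [← intervalIntegral.integral_const_mul]
    refine intervalIntegral.integral_mono_on hAB.le
      (hN.intervalIntegrable (by positivity) _ hA hB)
      ((hN.intervalIntegrable hs _ hA hB).const_mul _) fun r hr => ?_
    rw [mul_assoc]
    exact hN.map_mul_le hc hc1 (mul_nonneg hs (Real.rpow_nonneg (hA.le.trans hr.1) _))
  set x : Fin n → ℝ → ℝ := fun i => powerBump P A B I i
  have hxm : ∀ i, AEMeasurable (x i) halfLine := fun i => (powerBump_measurable _ _ _ _ _).aemeasurable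
  have hxd : ∀ i j, i ≠ j → DisjointSupports (x i) (x j) := fun i j hij =>
    ae_of_all _ (powerBump_disjoint hA hAB fun h => hij (Fin.ext h))
  have hmod : ∀ (a : Fin n → ℝ) (u : ℝ), 0 < u →
      ∫⁻ t, ENNReal.ofReal (N (|∑ k, a k * x k t| / u)) ∂halfLine =
        ENNReal.ofReal (∑ k, Φ (|a k| / u)) := by
    intro a u hu
    rw [lintegral_orlicz_disjoint_sum hN hxm hxd a hu,
      ENNReal.ofReal_sum_of_nonneg fun k _ => hΦ0 _ (by positivity)]
    exact Finset.sum_congr rfl fun k _ =>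
      lintegral_orlicz_powerBump hN hA hAB hI _ (by positivity)
  have hnorm : ∀ a : Fin n → ℝ, 0 < ‖WithLp.toLp p a‖ →
      |(∑ k, Φ (|a k| / ‖WithLp.toLp p a‖)) - 1| ≤ η := by
    intro a ha
    set ν := ‖WithLp.toLp p a‖ with hν
    have hsum : ∑ k, (|a k| / ν) ^ P = 1 := by
      have h1 : ν ^ P = ∑ k, |a k| ^ P := by
        have hnn : 0 ≤ ∑ k, |a k| ^ P := Finset.sum_nonneg fun k _ => by positivity
        rw [hν, PiLp.norm_eq_sum hp]
        simp only [Real.norm_eq_abs]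
        rw [← hP, ← Real.rpow_mul hnn, one_div_mul_cancel hp.ne', Real.rpow_one]
      simp only [Real.div_rpow (abs_nonneg _) ha.le]
      rw [← Finset.sum_div, ← h1, div_self (by positivity)]
    have hle : ∀ k, |a k| / ν ≤ 1 := by
      intro k
      have h1 := Finset.single_le_sum (f := fun k => (|a k| / ν) ^ P)
        (fun k _ => by positivity) (Finset.mem_univ k)
      rw [hsum] at h1
      rwa [← Real.rpow_le_rpow_iff (by positivity) zero_le_one hp, Real.one_rpow]
    rw [← hsum, ← Finset.sum_sub_distrib]
    calc |∑ k, (Φ (|a k| / ν) - (|a k| / ν) ^ P)| ≤ ∑ k, |Φ (|a k| / ν) - (|a k| / ν) ^ P| :=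
          Finset.abs_sum_le_sum_abs _ _
      _ ≤ ∑ k : Fin n, η / (n + 1) :=
          Finset.sum_le_sum fun k _ => hΦ1 _ (by positivity) (hle k)
      _ ≤ η := by
          rw [Finset.sum_const, Finset.card_univ, Fintype.card_fin, nsmul_eq_mul,
            mul_div_assoc', div_le_iff₀ (by positivity)]
          linarith
  have hup : ∀ a : Fin n → ℝ, 0 < ‖WithLp.toLp p a‖ →
      (1 + ε) * ‖WithLp.toLp p a‖ ∈ luxemburgSet N (fun t => ∑ k, a k * x k t) := by
    intro a ha
    refine ⟨by positivity, ?_⟩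
    rw [hmod a _ (by positivity), ENNReal.ofReal_le_one]
    have h1 := (abs_le.1 (hnorm a ha)).2
    calc ∑ k, Φ (|a k| / ((1 + ε) * ‖WithLp.toLp p a‖)) ≤
          ∑ k, (1 + ε)⁻¹ * Φ (|a k| / ‖WithLp.toLp p a‖) := by
          refine Finset.sum_le_sum fun k _ => ?_
          rw [show |a k| / ((1 + ε) * ‖WithLp.toLp p a‖) =
            (1 + ε)⁻¹ * (|a k| / ‖WithLp.toLp p a‖) by field_simp]
          exact hΦc _ _ (by positivity) (inv_le_one_of_one_le₀ (by linarith)) (by positivity)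
      _ ≤ (1 + ε)⁻¹ * (1 + η) := by
          rw [← Finset.mul_sum]; gcongr; linarith
      _ ≤ 1 := by
          rw [inv_mul_le_one₀ (by positivity)]
          have : η ≤ ε := div_le_self hε.le (by linarith)
          linarith
  have hlow : ∀ a : Fin n → ℝ, 0 < ‖WithLp.toLp p a‖ →
      ∀ u ∈ luxemburgSet N (fun t => ∑ k, a k * x k t), (1 + ε)⁻¹ * ‖WithLp.toLp p a‖ ≤ u := by
    rintro a ha u ⟨hu, hu1⟩
    by_contra! hlt
    rw [hmod a u hu, ENNReal.ofReal_le_one] at hu1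
    have h1 := (abs_le.1 (hnorm a ha)).1
    set ν := ‖WithLp.toLp p a‖
    have hlt' : (1 + ε) * u ≤ ν := by
      rw [inv_mul_eq_div, lt_div_iff₀ (by positivity)] at hlt; linarith
    have h2 : ∑ k, Φ (|a k| / ν) ≤ (1 + ε)⁻¹ * ∑ k, Φ (|a k| / u) := by
      rw [Finset.mul_sum]
      refine Finset.sum_le_sum fun k _ => ?_
      have h3 : u / ν ≤ (1 + ε)⁻¹ := by
        rw [div_le_iff₀ ha, inv_mul_eq_div, le_div_iff₀ (by positivity)]; linarith
      calc Φ (|a k| / ν) = Φ (u / ν * (|a k| / u)) := by congr 1; field_simp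
        _ ≤ u / ν * Φ (|a k| / u) := hΦc _ _ (by positivity)
            (h3.trans (inv_le_one_of_one_le₀ (by linarith))) (by positivity)
        _ ≤ _ := mul_le_mul_of_nonneg_right h3 (hΦ0 _ (by positivity))
    have h4 : (1 + ε)⁻¹ * ∑ k, Φ (|a k| / u) ≤ (1 + ε)⁻¹ * 1 := by gcongr
    have h5 : (1 + ε)⁻¹ < 1 - η := by
      rw [inv_lt_iff_one_lt_mul₀ (by positivity), hη]
      field_simp
      linarith
    linarith
  refine ⟨x, fun i => ⟨hxm i, ?_⟩, fun i j => powerBump_equimeasurable hA hAB hI _ _, hxd, ?_⟩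
  · have h1 := hup (Pi.single i 1) (by simp [PiLp.norm_eq_sum hp, hp.ne', ← hP, apply_ite])
    simp only [Pi.single_apply, ite_mul, one_mul, zero_mul, Finset.sum_ite_eq',
      Finset.mem_univ, if_true] at h1
    exact ⟨_, h1⟩
  · intro a
    by_cases ha : a = 0
    · have h1 : ‖WithLp.toLp p a‖ = 0 := by
        simp [ha, PiLp.norm_eq_sum hp, ← hP, hp.ne', Real.zero_rpow]
      have h2 : luxemburgSet N (fun t => ∑ k, a k * x k t) = Ioi 0 := by
        ext u
        simp [luxemburgSet, ha, hN.map_zero]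
      rw [h1, orliczNorm, h2, csInf_Ioi]
      simp
    · have hpos : 0 < ‖WithLp.toLp p a‖ := by
        obtain ⟨i, hi⟩ := Function.ne_iff.1 ha
        rw [PiLp.norm_eq_sum hp]
        refine Real.rpow_pos_of_pos (Finset.sum_pos' (fun k _ => by positivity)
          ⟨i, Finset.mem_univ _, ?_⟩) _
        exact Real.rpow_pos_of_pos (norm_pos_iff.2 hi) _
      exact ⟨le_csInf ⟨_, hup a hpos⟩ (hlow a hpos),
        csInf_le ⟨0, fun v hv => hv.1.le⟩ (hup a hpos)⟩

/-! ### Exponential growth away from a minimum -/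

/-- A discrete Gronwall argument: the hypothesis makes each new term at least `c / 2` times the
preceding partial sum, so partial sums grow by the factor `1 + c / 2`, and the last term dominates a
fixed fraction of the sum. -/
theorem exp_growth_of_sum_le {f : ℕ → ℝ} {c : ℝ} (hc : 0 < c) (hf : ∀ n, 0 < f n) {T : ℕ}
    (h : ∀ n ≤ T, c * ∑ k ∈ Finset.range (n + 1), f k ≤ 2 * f n) (i n : ℕ) (hin : i + n ≤ T) :
    c / 2 * (1 + c / 2) ^ n * f i ≤ f (i + n) := by
  have hS : ∀ n ≤ T, i ≤ n → (1 + c / 2) ^ (n - i) * f i ≤ ∑ k ∈ Finset.range (n + 1), f k := by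
    intro n hn hi
    induction n, hi using Nat.le_induction with
    | base =>
      simpa using Finset.single_le_sum (f := f) (fun k _ => (hf k).le)
        (Finset.mem_range.2 (Nat.lt_succ_self i))
    | succ n hi ih =>
      have h1 := ih (by omega)
      have h2 := h (n + 1) hn
      have h3 := hf (n + 1)
      rw [Finset.sum_range_succ] at h2 ⊢
      set S := ∑ k ∈ Finset.range (n + 1), f k
      rw [Nat.succ_sub hi, pow_succ]
      nlinarith
  have h1 := hS (i + n) hin (Nat.le_add_right _ _)
  rw [Nat.add_sub_cancel_left] at h1
  have h2 := h (i + n) hin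
  have h3 : c * ((1 + c / 2) ^ n * f i) ≤ 2 * f (i + n) := (by gcongr : _ ≤ _).trans h2
  linarith

/-- Starting the sum at a minimum `m` gives `g m + g (m + n) ≤ 2 * g (m + n)`, which puts the
one-sided Gronwall argument in force. -/
theorem exp_growth_right_of_min {g : ℤ → ℝ} {c : ℝ} (hc : 0 < c) (hg : ∀ k, 0 < g k)
    (h : ∀ (i : ℤ) (n : ℕ), c * ∑ k ∈ Finset.range (n + 1), g (i + k) ≤ g i + g (i + n))
    {m K : ℤ} (hm : ∀ k, m ≤ k → k ≤ K → g m ≤ g k) (i : ℤ) (n : ℕ) (hi : m ≤ i)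
    (hin : i + n ≤ K) : c / 2 * (1 + c / 2) ^ n * g i ≤ g (i + n) := by
  obtain ⟨i', hi'⟩ := Int.eq_ofNat_of_zero_le (sub_nonneg.2 hi)
  obtain ⟨T, hT⟩ := Int.eq_ofNat_of_zero_le (show 0 ≤ K - m by omega)
  have := exp_growth_of_sum_le (f := fun n => g (m + n)) (T := T) hc (fun n => hg _)
    (fun n hn => by
      have h1 := h m n
      have h2 := hm (m + n) (by omega) (by omega)
      linarith) i' n (by omega)
  have e1 : m + (i' : ℤ) = i := by omega
  have e2 : m + ((i' + n : ℕ) : ℤ) = i + n := by push_cast; omega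
  simpa only [e1, e2] using this

/-- `g` decays exponentially on `[-K, m]` and grows exponentially on `[m, K]`. -/
def IsValley (g : ℤ → ℝ) (c ρ : ℝ) (K : ℕ) (m : ℤ) : Prop :=
  (∀ (i : ℤ) (n : ℕ), m ≤ i → i + n ≤ K → c * ρ ^ n * g i ≤ g (i + n)) ∧
    ∀ (i : ℤ) (n : ℕ), i ≤ m → -K ≤ i - n → c * ρ ^ n * g i ≤ g (i - n)

theorem exists_isValley {g : ℤ → ℝ} {c : ℝ} (hc : 0 < c) (hg : ∀ k, 0 < g k)
    (h : ∀ (i : ℤ) (n : ℕ), c * ∑ k ∈ Finset.range (n + 1), g (i + k) ≤ g i + g (i + n))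
    (K : ℕ) : ∃ m, IsValley g (c / 2) (1 + c / 2) K m := by
  obtain ⟨m, hmK, hm⟩ := Finset.exists_min_image (Finset.Icc (-(K : ℤ)) K) g
    ⟨0, by simp⟩
  rw [Finset.mem_Icc] at hmK
  refine ⟨m, fun i n hi hin => exp_growth_right_of_min hc hg h (K := K)
    (fun k hk hk' => hm k (Finset.mem_Icc.2 ⟨hmK.1.trans hk, hk'⟩)) i n hi hin,
    fun i n hi hin => ?_⟩
  -- The hypothesis is symmetric in the two ends, so the left half follows by reflection.
  have := exp_growth_right_of_min (g := fun k => g (-k)) (m := -m) (K := K) hc (fun k => hg _)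
    (fun i n => by
      have h1 := h (-(i + n)) n
      rw [← Finset.sum_range_reflect] at h1
      have h2 : ∀ j ∈ Finset.range (n + 1), g (-(i + n) + ((n + 1 - 1 - j : ℕ) : ℤ)) = g (-(i + j)) := by
        intro j hj
        rw [Finset.mem_range] at hj
        congr 1
        omega
      rw [Finset.sum_congr rfl h2, show -(i + (n : ℤ)) + n = -i by omega] at h1
      linarith)
    (fun k hk hk' => by
      simp only [neg_neg]
      exact hm _ (Finset.mem_Icc.2 ⟨by omega, by omega⟩)) (-i) n (by omega) (by omega)
  simpa only [neg_neg, neg_add, ← sub_eq_add_neg] using this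

theorem IsValley.anti {g : ℤ → ℝ} {c ρ : ℝ} {K K' : ℕ} {m : ℤ} (h : IsValley g c ρ K' m)
    (hK : K ≤ K') : IsValley g c ρ K m :=
  ⟨fun i n hi hin => h.1 i n hi (by omega), fun i n hi hin => h.2 i n hi (by omega)⟩

/-- A compactness argument on the valley positions as `K` grows. A failure of growth to the right at
`i0` keeps all later valleys at or right of `i0`, and a failure to the left at `i1` keeps them at or
left of `i1`. Among the finitely many positions left, one works for every `K`. -/
theorem exists_global_valley {g : ℤ → ℝ} {c ρ : ℝ} (h : ∀ K, ∃ m, IsValley g c ρ K m) :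
    (∀ (i : ℤ) (n : ℕ), c * ρ ^ n * g i ≤ g (i + n)) ∨
    (∀ (i : ℤ) (n : ℕ), c * ρ ^ n * g i ≤ g (i - n)) ∨
    ∃ m : ℤ, (∀ (i : ℤ) (n : ℕ), m ≤ i → c * ρ ^ n * g i ≤ g (i + n)) ∧
      ∀ (i : ℤ) (n : ℕ), i ≤ m → c * ρ ^ n * g i ≤ g (i - n) := by
  by_contra hcon
  rw [not_or, not_or] at hcon
  obtain ⟨h1, h2, h3⟩ := hcon
  push Not at h1 h2
  obtain ⟨i0, n0, h1⟩ := h1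
  obtain ⟨i1, n1, h2⟩ := h2
  have h4 : ∀ m, ∃ K : ℕ, ¬ IsValley g c ρ K m := by
    intro m
    by_contra! h4
    refine h3 ⟨m, fun i n hi => (h4 (i + n).natAbs).1 i n hi (by omega),
      fun i n hi => (h4 (i - n).natAbs).2 i n hi (by omega)⟩
  choose κ hκ using h4
  -- Large enough to see both failures and to refute every candidate position in `[i0, i1]`.
  set K := (i0 + n0).natAbs + (i1 - n1).natAbs + ∑ m ∈ Finset.Icc i0 i1, κ m with hK
  obtain ⟨m, hm⟩ := h K
  have hm0 : i0 ≤ m := by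
    by_contra! hlt
    exact absurd (hm.1 i0 n0 hlt.le (by omega)) (not_le.2 h1)
  have hm1 : m ≤ i1 := by
    by_contra! hlt
    exact absurd (hm.2 i1 n1 hlt.le (by omega)) (not_le.2 h2)
  have hle : κ m ≤ K := (Finset.single_le_sum (f := κ) (fun _ _ => Nat.zero_le _)
    (Finset.mem_Icc.2 ⟨hm0, hm1⟩)).trans (by omega)
  exact hκ m (hm.anti hle)

/-! ### From exponential growth of dyadic masses to growth of `N` -/

/-- The gain `ρ ^ n` over `(a ^ p) ^ n` becomes a drop of `log_a ρ` in the exponent. Rounding to the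
grid of powers of `a` costs at most three steps, hence the factor `a ^ (3 * q)`. -/
theorem upperGrowth_of_geometric {N : ℝ → ℝ} (hN : IsOrliczFunction N) {p a c ρ : ℝ} (hp : 0 < p)
    (ha : 1 < a) (hc : 0 < c) (hρ : 1 < ρ) {K : Set ℤ} {S : Set ℝ}
    (hS : ∀ t ∈ S, 0 < t ∧ ∀ i : ℤ, a ^ (-i - 2) < t → i ∈ K)
    (h : ∀ i ∈ K, ∀ n : ℕ, c * ρ ^ n * N (a ^ (-i - 1)) ≤ (a ^ p) ^ n * N (a ^ (-(i + n)))) :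
    ∃ q, 0 < q ∧ q < p ∧ UpperGrowth N S q := by
  have ha0 : 0 < a := by linarith
  have hρ0 : 0 < ρ := by linarith
  -- The maximum with `p / 2` keeps the exponent positive.
  set q := max (p / 2) (p - Real.logb a ρ) with hq
  have hq0 : 0 < q := lt_of_lt_of_le (by positivity) (le_max_left _ _)
  refine ⟨q, hq0, max_lt (by linarith) (sub_lt_self _ (Real.logb_pos ha hρ)),
    c⁻¹ * a ^ (3 * q), by positivity, fun t ht s hs hst => ?_⟩
  have haq : a ^ p ≤ ρ * a ^ q := by
    calc a ^ p = ρ * a ^ (p - Real.logb a ρ) := by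
          rw [Real.rpow_sub ha0, Real.rpow_logb ha0 ha.ne' hρ0]; field_simp
      _ ≤ _ := by gcongr; exacts [ha.le, le_max_right _ _]
  obtain ⟨ht0, hK⟩ := hS t ht
  obtain ⟨e, he1, he2⟩ := exists_mem_Ioc_zpow ht0 ha
  obtain ⟨f, hf1, hf2⟩ := exists_mem_Ico_zpow hs ha
  have hfe : f ≤ e + 1 := (zpow_le_zpow_iff_right₀ ha).1 (hf1.trans (hst.trans he2))
  obtain ⟨n, hn⟩ := Int.eq_ofNat_of_zero_le (show 0 ≤ -f - (-e - 2) by omega)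
  have h1 := h (-e - 2) (hK _ (by rwa [show -(-e - 2) - 2 = e by omega])) n
  rw [show -(-e - 2) - 1 = e + 1 by omega, show -(-e - 2 + (n : ℤ)) = f by omega] at h1
  have h2 : c * N t ≤ (a ^ q) ^ n * N s := by
    refine le_of_mul_le_mul_left (a := ρ ^ n) ?_ (by positivity)
    have b1 : N t ≤ N (a ^ (e + 1)) := hN.mono ht0.le he2
    have b2 : N (a ^ f) ≤ N s := hN.mono (by positivity) hf1
    have b3 : 0 ≤ N (a ^ f) := hN.nonneg (by positivity)
    calc ρ ^ n * (c * N t) = c * ρ ^ n * N t := by ring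
      _ ≤ c * ρ ^ n * N (a ^ (e + 1)) := by gcongr
      _ ≤ (a ^ p) ^ n * N (a ^ f) := h1
      _ ≤ (ρ * a ^ q) ^ n * N s := by gcongr
      _ = _ := by rw [mul_pow]; ring
  have h3 : (a ^ q) ^ n ≤ a ^ (3 * q) * (t / s) ^ q := by
    have b1 : a ^ ((n : ℤ) - 3) ≤ t / s := by
      rw [le_div_iff₀ hs]
      calc a ^ ((n : ℤ) - 3) * s ≤ a ^ ((n : ℤ) - 3) * a ^ (f + 1) := by gcongr
        _ = a ^ e := by rw [← zpow_add₀ ha0.ne']; congr 1; omega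
        _ ≤ t := he1.le
    calc (a ^ q) ^ n = a ^ (3 * q) * (a ^ ((n : ℤ) - 3)) ^ q := by
          rw [← Real.rpow_natCast, ← Real.rpow_intCast, ← Real.rpow_mul ha0.le,
            ← Real.rpow_mul ha0.le, ← Real.rpow_add ha0]
          congr 1; push_cast; ring
      _ ≤ _ := by gcongr
  have h4 : c * N t ≤ a ^ (3 * q) * (t / s) ^ q * N s :=
    h2.trans (mul_le_mul_of_nonneg_right h3 (hN.nonneg hs.le))
  calc N t = c⁻¹ * (c * N t) := (inv_mul_cancel_left₀ hc.ne' _).symm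
    _ ≤ c⁻¹ * (a ^ (3 * q) * (t / s) ^ q * N s) := by gcongr
    _ = _ := by ring

theorem lowerGrowth_of_geometric {N : ℝ → ℝ} (hN : IsOrliczFunction N) {p a c ρ : ℝ} (hp : 0 < p)
    (ha : 1 < a) (hc : 0 < c) (hc1 : c ≤ 1) (hρ : 1 < ρ) {K : Set ℤ} {S : Set ℝ}
    (hS : ∀ t ∈ S, 0 < t ∧ ∀ i : ℤ, t ≤ a ^ (-i - 1) → i ∈ K)
    (h : ∀ i ∈ K, ∀ n : ℕ, c * ρ ^ n * (a ^ p) ^ n * N (a ^ (-i - 1)) ≤ N (a ^ (-(i - n)))) :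
    ∃ q, p < q ∧ LowerGrowth N S q := by
  have ha0 : 0 < a := by linarith
  have hρ0 : 0 < ρ := by linarith
  have hlog := Real.logb_pos ha hρ
  set q := p + Real.logb a ρ with hq
  have hq0 : 0 < q := by positivity
  have haq : a ^ q = ρ * a ^ p := by
    rw [hq, Real.rpow_add ha0, Real.rpow_logb ha0 ha.ne' hρ0, mul_comm]
  refine ⟨q, by linarith, c⁻¹ * a ^ (3 * q), by positivity, fun s hs t hst => ?_⟩
  obtain ⟨hs0, hK⟩ := hS s hs
  have ht0 := hs0.trans_le hst
  obtain ⟨e, he1, he2⟩ := exists_mem_Ioc_zpow hs0 ha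
  obtain ⟨f, hf1, hf2⟩ := exists_mem_Ico_zpow ht0 ha
  have hts : t / s ≤ a ^ (f - e + 1) := by
    rw [div_le_iff₀ hs0]
    calc t ≤ a ^ (f + 1) := hf2.le
      _ = a ^ (f - e + 1) * a ^ e := by rw [← zpow_add₀ ha0.ne']; congr 1; omega
      _ ≤ _ := by gcongr
  have hNs := hN.nonneg hs0.le
  rw [mul_assoc, le_inv_mul_iff₀ hc]
  -- When `t` and `s` are too few grid steps apart for the geometric estimate, `t / s` is bounded
  -- and monotonicity suffices.
  rcases le_or_gt 0 (f - e - 2) with h0 | h0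
  · obtain ⟨n, hn⟩ := Int.eq_ofNat_of_zero_le h0
    have h1 := h (-e - 2) (hK _ (by rwa [show -(-e - 2) - 1 = e + 1 by omega])) n
    rw [show -(-e - 2) - 1 = e + 1 by omega, show -(-e - 2 - (n : ℤ)) = f by omega] at h1
    have h3 : (t / s) ^ q ≤ a ^ (3 * q) * (ρ ^ n * (a ^ p) ^ n) := by
      calc (t / s) ^ q ≤ (a ^ (f - e + 1)) ^ q := by gcongr
        _ = a ^ (3 * q) * (a ^ q) ^ n := by
          rw [show f - e + 1 = (n : ℤ) + 3 by omega, ← Real.rpow_natCast, ← Real.rpow_intCast,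
            ← Real.rpow_mul ha0.le, ← Real.rpow_mul ha0.le, ← Real.rpow_add ha0]
          congr 1; push_cast; ring
        _ = _ := by rw [haq, mul_pow]
    have b1 : N s ≤ N (a ^ (e + 1)) := hN.mono hs0.le he2
    have b2 : N (a ^ f) ≤ N t := hN.mono (by positivity) hf1
    calc c * ((t / s) ^ q * N s) ≤
          c * (a ^ (3 * q) * (ρ ^ n * (a ^ p) ^ n) * N (a ^ (e + 1))) := by gcongr
      _ = a ^ (3 * q) * (c * ρ ^ n * (a ^ p) ^ n * N (a ^ (e + 1))) := by ring
      _ ≤ a ^ (3 * q) * N t := by gcongr; exact h1.trans b2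
  · have h3 : (t / s) ^ q ≤ a ^ (3 * q) := by
      calc (t / s) ^ q ≤ (a ^ (3 : ℤ)) ^ q := by
            refine Real.rpow_le_rpow (by positivity) (hts.trans ?_) hq0.le
            exact zpow_le_zpow_right₀ ha.le (by omega)
        _ = _ := by
          rw [← Real.rpow_intCast, ← Real.rpow_mul ha0.le]; norm_num
    have h5 := hN.mono hs0.le hst
    calc c * ((t / s) ^ q * N s) ≤ 1 * (a ^ (3 * q) * N t) := by gcongr
      _ = _ := one_mul _

/-- Clamping both arguments at `t₀` changes `N t` by a bounded factor and does not increase the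
quotient. This moves the cut-off from the bottom of a valley to the value `N⁻¹(1)` used in the
indices. -/
theorem UpperGrowth.extend {N : ℝ → ℝ} (hN : IsOrliczFunction N) {q t₀ t₁ : ℝ} (hq : 0 < q)
    (h₀ : 0 < t₀) (h : UpperGrowth N (Ioc 0 t₀) q) : UpperGrowth N (Ioc 0 t₁) q := by
  obtain ⟨C, hC, hG⟩ := h
  set D := max 1 (N t₁ / N t₀)
  have hD : 0 < D := lt_of_lt_of_le one_pos (le_max_left _ _)
  refine ⟨D * C, by positivity, fun t ht s hs hst => ?_⟩
  have ht0 : 0 < t := ht.1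
  have h1 := hG (min t t₀) ⟨lt_min ht0 h₀, min_le_right _ _⟩ (min s t₀) (lt_min hs h₀)
    (min_le_min_right _ hst)
  have h2 : N t ≤ D * N (min t t₀) := by
    rcases le_total t t₀ with h3 | h3
    · rw [min_eq_left h3]
      exact le_mul_of_one_le_left (hN.nonneg ht0.le) (le_max_left _ _)
    · rw [min_eq_right h3]
      refine (hN.mono ht0.le ht.2).trans ?_
      rw [← div_le_iff₀ (hN.pos h₀)]
      exact le_max_right _ _
  have h3 : min t t₀ / min s t₀ ≤ t / s := by
    rcases le_total s t₀ with h3 | h3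
    · rw [min_eq_left h3]; gcongr; exact min_le_left _ _
    · rw [min_eq_right h3, min_eq_right (h3.trans hst), div_self h₀.ne', one_le_div hs]
      exact hst
  have h4 : N (min s t₀) ≤ N s := hN.mono (lt_min hs h₀).le (min_le_left _ _)
  have h5 : 0 < min s t₀ := lt_min hs h₀
  have h6 : 0 < min t t₀ := lt_min ht0 h₀
  have h7 := hN.nonneg h5.le
  calc N t ≤ D * N (min t t₀) := h2
    _ ≤ D * (C * ((min t t₀ / min s t₀) ^ q * N (min s t₀))) := by gcongr
    _ ≤ D * (C * ((t / s) ^ q * N s)) := by gcongr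
    _ = _ := by ring

theorem LowerGrowth.extend {N : ℝ → ℝ} (hN : IsOrliczFunction N) {q t₀ t₁ : ℝ} (hq : 0 < q)
    (h₀ : 0 < t₀) (h₁ : 0 < t₁) (h : LowerGrowth N (Ici t₀) q) : LowerGrowth N (Ici t₁) q := by
  obtain ⟨C, hC, hG⟩ := h
  set D := max 1 (N t₀ / N t₁)
  have hD : 0 < D := lt_of_lt_of_le one_pos (le_max_left _ _)
  set E := max 1 (t₀ / t₁)
  have hE : 0 < E := lt_of_lt_of_le one_pos (le_max_left _ _)
  refine ⟨E ^ q * (C * D), by positivity, fun s hs t hst => ?_⟩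
  have hs0 : 0 < s := h₁.trans_le hs
  have ht0 := hs0.trans_le hst
  have h1 := hG (max s t₀) (mem_Ici.2 (le_max_right _ _)) (max t t₀) (max_le_max_right _ hst)
  have h2 : N (max t t₀) ≤ D * N t := by
    rcases le_total t₀ t with h3 | h3
    · rw [max_eq_left h3]
      exact le_mul_of_one_le_left (hN.nonneg ht0.le) (le_max_left _ _)
    · rw [max_eq_right h3]
      have h4 : N t₁ ≤ N t := hN.mono h₁.le (le_trans hs hst)
      calc N t₀ = N t₀ / N t₁ * N t₁ := (div_mul_cancel₀ _ (hN.pos h₁).ne').symm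
        _ ≤ D * N t := mul_le_mul (le_max_right _ _) h4 (hN.nonneg h₁.le) hD.le
  have h3 : t / s ≤ E * (max t t₀ / max s t₀) := by
    rcases le_total t₀ s with h3 | h3
    · rw [max_eq_left h3, max_eq_left (h3.trans hst)]
      exact le_mul_of_one_le_left (by positivity) (le_max_left _ _)
    · rw [max_eq_right h3]
      calc t / s ≤ t / t₁ := by gcongr; exact hs
        _ = t₀ / t₁ * (t / t₀) := by field_simp
        _ ≤ _ := by gcongr; exacts [le_max_right _ _, le_max_left _ _]
  have h4 : N s ≤ N (max s t₀) := hN.mono hs0.le (le_max_left _ _)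
  have h5 := hN.nonneg hs0.le
  calc (t / s) ^ q * N s ≤ (E * (max t t₀ / max s t₀)) ^ q * N (max s t₀) := by gcongr
    _ = E ^ q * ((max t t₀ / max s t₀) ^ q * N (max s t₀)) := by
      rw [Real.mul_rpow hE.le (by positivity), mul_assoc]
    _ ≤ E ^ q * (C * N (max t t₀)) := by gcongr
    _ ≤ E ^ q * (C * (D * N t)) := by gcongr
    _ = _ := by ring

/-- The integrand is decreasing and takes the values `N (a ^ (-k))` and `N (a ^ (-k - 1))` at the
endpoints. -/
theorem integral_geometric_bounds {N : ℝ → ℝ} (hN : IsOrliczFunction N) {p a : ℝ} (hp : 0 < p)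
    (ha : 1 < a) (k : ℤ) :
    (a ^ p - 1) * (a ^ p) ^ k * N (a ^ (-k - 1)) ≤
        ∫ r in (a ^ p) ^ k..(a ^ p) ^ (k + 1), N (r ^ (-(1 / p))) ∧
      ∫ r in (a ^ p) ^ k..(a ^ p) ^ (k + 1), N (r ^ (-(1 / p))) ≤
        (a ^ p - 1) * (a ^ p) ^ k * N (a ^ (-k)) := by
  have ha0 : 0 < a := by linarith
  have hL : 1 < a ^ p := Real.one_lt_rpow ha hp
  have hL0 : 0 < a ^ p := by linarith
  have hk : 0 < (a ^ p) ^ k := zpow_pos hL0 k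
  have hk1 : 0 < (a ^ p) ^ (k + 1) := zpow_pos hL0 _
  have hle : (a ^ p) ^ k ≤ (a ^ p) ^ (k + 1) := zpow_le_zpow_right₀ hL.le (by omega)
  have hroot : ∀ j : ℤ, ((a ^ p) ^ j) ^ (-(1 / p)) = a ^ (-j) := by
    intro j
    rw [← Real.rpow_intCast, ← Real.rpow_mul ha0.le, ← Real.rpow_mul ha0.le, ← Real.rpow_intCast]
    congr 1
    push_cast
    field_simp
  have hlen : (a ^ p) ^ (k + 1) - (a ^ p) ^ k = (a ^ p - 1) * (a ^ p) ^ k := by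
    rw [zpow_add_one₀ hL0.ne']; ring
  have hint := hN.intervalIntegrable_one (-(1 / p)) hk hk1
  have hneg : -(1 / p) ≤ 0 := by
    have : 0 < 1 / p := by positivity
    linarith
  constructor
  · have := intervalIntegral.integral_mono_on hle
      (intervalIntegrable_const (c := N (a ^ (-k - 1)))) hint fun r hr => by
        refine hN.mono (by positivity) ?_
        rw [show -k - 1 = -(k + 1) by omega, ← hroot]
        exact Real.rpow_le_rpow_of_nonpos (hk.trans_le hr.1) hr.2 hneg
    rwa [intervalIntegral.integral_const, smul_eq_mul, hlen] at this
  · have := intervalIntegral.integral_mono_on hle hint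
      (intervalIntegrable_const (c := N (a ^ (-k)))) fun r hr => by
        refine hN.mono (Real.rpow_nonneg (hk.le.trans hr.1) _) ?_
        rw [← hroot]
        exact Real.rpow_le_rpow_of_nonpos hk hr.1 hneg
    rwa [intervalIntegral.integral_const, smul_eq_mul, hlen] at this

/-- Failure of broad windows for one pair `L`, `ε` says that the end masses control every sum of
masses over the intervals `[L ^ k, L ^ (k + 1)]`. As these masses are of the order of `L ^ k * N (a
^ (-k))` up to a shift of the index, with `a ^ p = L`, their exponential growth is power growth of
`N` relative to `t ^ p`. Growth as `k` increases concerns small `t`. -/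
theorem indices_of_not_hasBroadWindows {N : ℝ → ℝ} (hN : IsOrliczFunction N) {p : ℝ} (hp : 0 < p)
    (h : ¬ HasBroadWindows N p) :
    orliczBeta N < 1 / p ∨ 1 / p < orliczAlpha N ∨
      (orliczBetaZero N < 1 / p ∧ 1 / p < orliczAlphaInfty N) := by
  unfold HasBroadWindows at h
  push Not at h
  obtain ⟨L, ε, hL, hε, hw⟩ := h
  have hL0 : 0 < L := by linarith
  obtain ⟨a, ha, rfl⟩ : ∃ a : ℝ, 1 < a ∧ a ^ p = L :=
    ⟨L ^ (1 / p), Real.one_lt_rpow hL (by positivity), by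
      rw [← Real.rpow_mul hL0.le, one_div_mul_cancel hp.ne', Real.rpow_one]⟩
  have ha0 : 0 < a := by linarith
  set g : ℤ → ℝ := fun k => ∫ r in (a ^ p) ^ k..(a ^ p) ^ (k + 1), N (r ^ (-(1 / p))) with hg
  have hg0 : ∀ k, 0 < g k := fun k =>
    hN.integral_pos _ (zpow_pos hL0 k) (zpow_lt_zpow_right₀ hL (by omega))
  -- The window excludes its last block; including it in the sum changes `ε` to `ε / (1 + ε)`.
  set c := ε / (1 + ε) with hc
  have hc0 : 0 < c := by positivity
  have hc1 : c ≤ 1 := (div_le_one (by positivity)).2 (by linarith)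
  have hsum : ∀ (i : ℤ) (n : ℕ), c * ∑ k ∈ Finset.range (n + 1), g (i + k) ≤ g i + g (i + n) := by
    intro i n
    rcases Nat.eq_zero_or_pos n with rfl | hn
    · have := hg0 i
      simp only [zero_add, Finset.sum_range_one, Nat.cast_zero, add_zero]
      nlinarith
    have h1 := hw ((a ^ p) ^ i) ((a ^ p) ^ (i + n)) (zpow_pos hL0 _)
      (zpow_lt_zpow_right₀ hL (by omega))
    have h2 : ∑ k ∈ Finset.range n, g (i + k) =
        ∫ r in (a ^ p) ^ i..(a ^ p) ^ (i + n), N (r ^ (-(1 / p))) := by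
      have := intervalIntegral.sum_integral_adjacent_intervals
        (a := fun k : ℕ => (a ^ p) ^ (i + (k : ℤ))) (n := n)
        (f := fun r => N (r ^ (-(1 / p)))) (μ := volume)
        (fun k _ => hN.intervalIntegrable_one _ (zpow_pos hL0 _) (zpow_pos hL0 _))
      simpa [hg, add_assoc] using this
    rw [← zpow_one_add₀ hL0.ne', ← zpow_one_add₀ hL0.ne', ← h2, add_comm 1 i,
      add_comm 1 (i + (n : ℤ))] at h1
    rw [Finset.sum_range_succ, hc, div_mul_eq_mul_div, div_le_iff₀ (by positivity)]
    have h3 := hg0 i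
    have h4 := hg0 (i + n)
    change ε * ∑ k ∈ Finset.range n, g (i + k) < g i + g (i + n) at h1
    nlinarith
  have hlow := fun k => (integral_geometric_bounds hN hp ha k).1
  have hupp := fun k => (integral_geometric_bounds hN hp ha k).2
  have hU : ∀ (i : ℤ) (n : ℕ), c / 2 * (1 + c / 2) ^ n * g i ≤ g (i + n) →
      c / 2 * (1 + c / 2) ^ n * N (a ^ (-i - 1)) ≤ (a ^ p) ^ n * N (a ^ (-(i + n))) := by
    intro i n h1
    refine le_of_mul_le_mul_left (a := (a ^ p - 1) * (a ^ p) ^ i) ?_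
      (mul_pos (by linarith) (zpow_pos hL0 _))
    calc _ = c / 2 * (1 + c / 2) ^ n * ((a ^ p - 1) * (a ^ p) ^ i * N (a ^ (-i - 1))) := by ring
      _ ≤ c / 2 * (1 + c / 2) ^ n * g i := by gcongr; exact hlow i
      _ ≤ _ := h1.trans (hupp _)
      _ = _ := by rw [zpow_add₀ hL0.ne', zpow_natCast]; ring
  have hD : ∀ (i : ℤ) (n : ℕ), c / 2 * (1 + c / 2) ^ n * g i ≤ g (i - n) →
      c / 2 * (1 + c / 2) ^ n * (a ^ p) ^ n * N (a ^ (-i - 1)) ≤ N (a ^ (-(i - n))) := by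
    intro i n h1
    refine le_of_mul_le_mul_left (a := (a ^ p - 1) * (a ^ p) ^ (i - n)) ?_
      (mul_pos (by linarith) (zpow_pos hL0 _))
    have e : (a ^ p) ^ i = (a ^ p) ^ (i - n) * (a ^ p) ^ n := by
      rw [← zpow_natCast, ← zpow_add₀ hL0.ne', sub_add_cancel]
    calc _ = c / 2 * (1 + c / 2) ^ n * ((a ^ p - 1) * (a ^ p) ^ i * N (a ^ (-i - 1))) := by
          rw [e]; ring
      _ ≤ c / 2 * (1 + c / 2) ^ n * g i := by gcongr; exact hlow i
      _ ≤ _ := h1.trans (hupp _)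
  have hρ : 1 < 1 + c / 2 := by linarith
  -- Valley at minus infinity: `1/p < α`. Valley at plus infinity: `β < 1/p`. Finite valley: the
  -- mixed condition on `α^∞` and `β⁰`.
  rcases exists_global_valley (exists_isValley hc0 hg0 hsum) with h1 | h1 | ⟨m, h1, h2⟩
  · obtain ⟨q, hq0, hqp, hG⟩ := upperGrowth_of_geometric hN (K := univ) (S := Ioi 0) hp ha
      (by positivity) hρ (fun t ht => ⟨ht, fun _ _ => trivial⟩) fun i _ n => hU i n (h1 i n)
    exact Or.inr (Or.inl (lt_orliczAlpha_of_upperGrowth hN hq0 hqp hG))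
  · obtain ⟨q, hqp, hG⟩ := lowerGrowth_of_geometric hN (K := univ) (S := Ioi 0) hp ha
      (by positivity) (by linarith) hρ (fun t ht => ⟨ht, fun _ _ => trivial⟩)
      fun i _ n => hD i n (h1 i n)
    exact Or.inl (orliczBeta_lt_of_lowerGrowth hN hp hqp hG)
  · have h₀ : 0 < a ^ (-m - 1) := zpow_pos ha0 _
    have h₁ := orliczInv_pos hN one_pos
    obtain ⟨q, hq0, hqp, hG⟩ := upperGrowth_of_geometric hN (K := {i | m ≤ i})
      (S := Ioc 0 (a ^ (-m - 1))) hp ha (by positivity) hρ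
      (fun t ht => ⟨ht.1, fun i hi => by
        have := (zpow_lt_zpow_iff_right₀ ha).1 (hi.trans_le ht.2)
        show m ≤ i
        omega⟩) fun i hi n => hU i n (h1 i n hi)
    obtain ⟨q', hqp', hG'⟩ := lowerGrowth_of_geometric hN (K := {i | i ≤ m})
      (S := Ici (a ^ (-m - 1))) hp ha (by positivity) (by linarith) hρ
      (fun t ht => ⟨h₀.trans_le ht, fun i hi => by
        have := (zpow_le_zpow_iff_right₀ ha).1 (le_trans ht hi)
        show i ≤ m
        omega⟩) fun i hi n => hD i n (h2 i n hi)
    exact Or.inr (Or.inr ⟨orliczBetaZero_lt_of_lowerGrowth hN hp hqp'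
      (hG'.extend hN (hp.trans hqp') h₀ h₁),
      lt_orliczAlphaInfty_of_upperGrowth hN hq0 hqp (hG.extend hN hq0 h₀)⟩)

/-! ### The set of represented exponents -/

/-- Characterization of the exponents `p` for which `ℓ^p` is symmetrically finitely
represented. -/
theorem symmFinitelyRepresented_iff {N : ℝ → ℝ} (hN : IsOrliczFunction N) {p : ℝ≥0∞}
    (hp : 0 < p.toReal) : SymmFinitelyRepresented N p ↔
      (1 / p.toReal ≤ orliczBeta N ∧ orliczAlpha N ≤ 1 / p.toReal) ∧
        (1 / p.toReal ≤ orliczBetaZero N ∨ orliczAlphaInfty N ≤ 1 / p.toReal) := by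
  have key : SymmFinitelyRepresented N p ↔
      ¬ (orliczBeta N < 1 / p.toReal ∨ 1 / p.toReal < orliczAlpha N ∨
        (orliczBetaZero N < 1 / p.toReal ∧ 1 / p.toReal < orliczAlphaInfty N)) := by
    constructor
    · intro h hbad
      exact (steepAround_of_indices hN hp hbad).not_symmFinitelyRepresented hN hp h
    · intro h
      by_contra hF
      exact h (indices_of_not_hasBroadWindows hN hp fun hw => hF (hw.symmFinitelyRepresented hN hp))
  rw [key]
  simp only [not_or, not_and_or, not_lt, and_assoc]

/-- Positivity of `α` is what removes `p = ∞`. The requirement `1 ≤ p` follows from `1/p ≤ β ≤ 1`.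
-/
theorem mem_symmReprSet_iff {N : ℝ → ℝ} (hN : IsOrliczFunction N) (hα : 0 < orliczAlpha N)
    (p : ℝ≥0∞) : p ∈ symmReprSet N ↔ p ≠ ∞ ∧ 0 < p.toReal ∧
      (1 / p.toReal ≤ orliczBeta N ∧ orliczAlpha N ≤ 1 / p.toReal) ∧
        (1 / p.toReal ≤ orliczBetaZero N ∨ orliczAlphaInfty N ≤ 1 / p.toReal) := by
  constructor
  · rintro ⟨h1, hF⟩
    have hp : p ≠ ∞ := by
      rintro rfl
      obtain ⟨r, hr, hrα⟩ := exists_between hα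
      obtain ⟨q, -, -, hG⟩ := exists_upperGrowth_of_lt_orliczAlpha hN (p := 1 / r)
        (one_div_pos.2 hr) (by rwa [one_div_one_div])
      exact hG.not_symmFinitelyRepresented_top hN hF
    have hp0 : 0 < p.toReal := ENNReal.toReal_pos (zero_lt_one.trans_le h1).ne' hp
    exact ⟨hp, hp0, (symmFinitelyRepresented_iff hN hp0).1 hF⟩
  · rintro ⟨hp, hp0, h⟩
    refine ⟨?_, (symmFinitelyRepresented_iff hN hp0).2 h⟩
    have h1 := h.1.1.trans (orliczBeta_le_one hN)
    rw [div_le_one hp0] at h1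
    rwa [← ENNReal.ofReal_toReal hp, ENNReal.one_le_ofReal]

theorem mem_Icc_ofReal_one_div_iff {a b : ℝ} (ha : 0 < a) (hb : 0 < b) (p : ℝ≥0∞) :
    p ∈ Icc (ENNReal.ofReal (1 / b)) (ENNReal.ofReal (1 / a)) ↔
      p ≠ ∞ ∧ 0 < p.toReal ∧ 1 / p.toReal ≤ b ∧ a ≤ 1 / p.toReal := by
  constructor
  · rintro ⟨h1, h2⟩
    have hp := ne_top_of_le_ne_top ENNReal.ofReal_ne_top h2
    rw [ENNReal.ofReal_le_iff_le_toReal hp] at h1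
    have hp0 : 0 < p.toReal := (one_div_pos.2 hb).trans_le h1
    rw [ENNReal.le_ofReal_iff_toReal_le hp (by positivity)] at h2
    exact ⟨hp, hp0, (one_div_le hb hp0).1 h1, (le_one_div hp0 ha).1 h2⟩
  · rintro ⟨hp, hp0, h1, h2⟩
    rw [mem_Icc, ENNReal.ofReal_le_iff_le_toReal hp,
      ENNReal.le_ofReal_iff_toReal_le hp (by positivity)]
    exact ⟨(one_div_le hp0 hb).1 h1, (le_one_div ha hp0).1 h2⟩

theorem mainTheorem6 (N : ℝ → ℝ) (hN : IsOrliczFunction N) (hα : 0 < orliczAlpha N) :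
    (orliczAlphaInfty N ≤ orliczBetaZero N →
      symmReprSet N =
        Icc (ENNReal.ofReal (1 / orliczBeta N)) (ENNReal.ofReal (1 / orliczAlpha N))) ∧
    (orliczBetaZero N < orliczAlphaInfty N →
      symmReprSet N =
        Icc (ENNReal.ofReal (1 / orliczBeta N)) (ENNReal.ofReal (1 / orliczAlphaInfty N)) ∪
        Icc (ENNReal.ofReal (1 / orliczBetaZero N)) (ENNReal.ofReal (1 / orliczAlpha N))) := by
  have h1 := orliczAlpha_le_orliczBetaZero hN
  have h2 := orliczBetaZero_le_orliczBeta hN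
  have h3 := orliczAlpha_le_orliczAlphaInfty hN
  have hβ0 : 0 < orliczBetaZero N := hα.trans_le h1
  have hβ : 0 < orliczBeta N := hβ0.trans_le h2
  have hα' : 0 < orliczAlphaInfty N := hα.trans_le h3
  constructor
  · intro h
    ext p
    rw [mem_symmReprSet_iff hN hα, mem_Icc_ofReal_one_div_iff hα hβ]
    constructor
    · rintro ⟨hp, hp0, ⟨ha, hb⟩, -⟩
      exact ⟨hp, hp0, ha, hb⟩
    · rintro ⟨hp, hp0, ha, hb⟩
      refine ⟨hp, hp0, ⟨ha, hb⟩, ?_⟩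
      -- When `α^∞ ≤ β⁰` the mixed condition excludes nothing: every `1/p` lies below `β⁰` or above
      -- `α^∞`.
      rcases le_total (1 / p.toReal) (orliczBetaZero N) with h' | h'
      · exact Or.inl h'
      · exact Or.inr (h.trans h')
  · intro h
    ext p
    rw [mem_union, mem_symmReprSet_iff hN hα, mem_Icc_ofReal_one_div_iff hα' hβ,
      mem_Icc_ofReal_one_div_iff hα hβ0]
    constructor
    · rintro ⟨hp, hp0, ⟨ha, hb⟩, hc | hc⟩
      · exact Or.inr ⟨hp, hp0, hc, hb⟩
      · exact Or.inl ⟨hp, hp0, ha, hc⟩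
    · rintro (⟨hp, hp0, ha, hb⟩ | ⟨hp, hp0, ha, hb⟩)
      · exact ⟨hp, hp0, ⟨ha, h3.trans hb⟩, Or.inr hb⟩
      · exact ⟨hp, hp0, ⟨ha.trans h2, hb⟩, Or.inl ha⟩
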